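/- Let $(X,\mu)$ be a measure space, let $\mathcal E$ be a closed, nonnegative, symmetric bilinear form on $L^2(X,\mu)$ with domain $H_{\mathcal L}$, and let $\mathcal L$ be the operator given by $\langle \mathcal L f,g\rangle=\mathcal E(f,g)$ for $f,g\in H_{\mathcal L}$; write $\overline{\mathcal E}(f)=\mathcal E(f,f)$. (For example, $X=\mathbb R^N$ with Lebesgue measure and $\mathcal E(f,g)=\frac12\iint (f(x)-f(y))(g(x)-g(y))J(x,y)\,dx\,dy$ on $H_{\mathcal L}=\{f\in L^2:\overline{\mathcal E}(f)<\infty\}$, for a symmetric Lévy kernel $J\ge 0$.) For $u_0\in L^2$ let $u(t)=e^{-t\mathcal L}u_0$ be the mild solution of $\partial_t u+\mathcal L u=0$, $u(0)=u_0$, that is, $u\in C([0,\infty);L^2)\cap C^1((0,\infty);L^2)\cap C((0,\infty);H_{\mathcal L})$ and $\langle u'(t),g\rangle+\mathcal E(u(t),g)=0$ for all $t>0$ and $g\in H_{\mathcal L}$. Assume that $e^{-t\mathcal L}$ is a symmetric Markov semigroup, i.e. for every $t\ge 0$ the operator $e^{-t\mathcal L}:L^2\to L^2$ is well defined, preserves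 positivity and satisfies $\|e^{-t\mathcal L}u_0\|_\infty\le\|u_0\|_\infty$. The semigroup is called *supercontractive* if there is a function $B(t,q)\ge 0$ with $$\|u(t)\|_q\le B(t,q)\,\|u_0\|_2\qquad\text{for all } 2\le q<\infty,\ t>0,\ u_0\in L^2, \tag{1}$$ and *ultracontractive* if moreover $B$ can be chosen such that $B(t):=\sup_{2\le q<\infty}B(t,q)<\infty$ for all $t>0$, so that in particular $$\|u(t)\|_\infty\le B(t)\,\|u_0\|_2\qquad\text{for all } t>0,\ u_0\in L^2. \tag{2}$$ Let $\mathrm{Ent}(f)=\int_X\Phi(|f|)\,d\mu-\Phi\big(\int_X|f|\,d\mu\big)$ with $\Phi(s)=s\log s$, $\Phi(0)=0$. For a function $\beta:(0,\infty)\to\mathbb R$ consider the family of logarithmic Sobolev inequalities $$\mathrm{Ent}(f^2)\le 2\beta(\varepsilon)\|f\|_2^2+2\varepsilon\,\overline{\mathcal E}(f)\qquad\text{for all }\varepsilon>0\text{ and all } f\in L^1(X,\mu)\cap H_{\mathcal L} \tag{3}$$ (which includes the assertion that $f^2\log f^2$ is integrable). **Theorem.** 1. If (1) holds, then for every $2<q<\infty$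 the family (3) holds with $\beta(\varepsilon)=(1-2/q)^{-1}\log B\big(\varepsilon(1-2/q),q\big)$. 2. If (2) holds with a function $B(t)\ge 0$, then (3) holds with $\beta(\varepsilon)=\log B(\varepsilon)$. 3. Conversely, if (3) holds with some continuous function $\beta:(0,\infty)\to\mathbb R$, then the semigroup is supercontractive. 4. If, in addition, $\frac1t\int_0^t\beta(s)\,ds<\infty$ for all $t>0$, then the semigroup is ultracontractive. (If $L^2(X,\mu)=\{0\}$, everything is trivial and $\log 0$ is given an arbitrary real value; otherwise $B>0$ automatically.) -/

import Mathlib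

open MeasureTheory Set Filter Topology

/-- A closed, nonnegative, symmetric bilinear form `𝓔` on `L²(X, μ)`, with form domain `H`. The
operator `𝓛` of the form is understood through `⟨𝓛 f, g⟩ = 𝓔(f, g)` for `f, g ∈ H`. -/
structure ClosedForm {X : Type*} [MeasurableSpace X] (μ : Measure X) where
  /-- the form domain `H ⊆ L²(X, μ)` -/
  domain : Submodule ℝ (Lp ℝ 2 μ)
  /-- the form `𝓔(f, g)` for `f, g ∈ H` -/
  form : domain →ₗ[ℝ] domain →ₗ[ℝ] ℝ
  symm : ∀ f g, form f g = form g f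
  nonneg : ∀ f, 0 ≤ form f f
  /-- closedness: `H` is complete for the norm `‖f‖₂ + 𝓔(f, f)^{1/2}` -/
  closed : ∀ (u : ℕ → domain) (f : Lp ℝ 2 μ),
    Tendsto (fun n => (u n : Lp ℝ 2 μ)) atTop (𝓝 f) →
    Tendsto (fun k : ℕ × ℕ => form (u k.1 - u k.2) (u k.1 - u k.2)) atTop (𝓝 0) →
    ∃ hf : f ∈ domain,
      Tendsto (fun n => form (u n - ⟨f, hf⟩) (u n - ⟨f, hf⟩)) atTop (𝓝 0)

/-- The energy `𝓔(f, f)` of `f ∈ H`. -/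
def ClosedForm.energy {X : Type*} [MeasurableSpace X] {μ : Measure X} (E : ClosedForm μ)
    (f : E.domain) : ℝ :=
  E.form f f

/-- `u` is the mild solution of `∂ₜ u + 𝓛 u = 0` in `(0, ∞)`, `u(0) = u₀`:
`u ∈ C([0, ∞); L²) ∩ C¹((0, ∞); L²) ∩ C((0, ∞); H)`, and the equation holds against every
`g ∈ H`. (Only the values of `u` on `[0, ∞)` matter.) -/
structure IsMildSolution {X : Type*} [MeasurableSpace X] {μ : Measure X} (E : ClosedForm μ)
    (u₀ : Lp ℝ 2 μ) (u : ℝ → Lp ℝ 2 μ) : Prop where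
  initial : u 0 = u₀
  continuousOn : ContinuousOn u (Ici 0)
  contDiffOn : ContDiffOn ℝ 1 u (Ioi 0)
  mem_domain : ∀ t : ℝ, 0 < t → u t ∈ E.domain
  energy_continuous : ∀ (t : ℝ) (ht : 0 < t),
    Tendsto (fun s : Ioi (0 : ℝ) =>
        E.energy (⟨u s, mem_domain s s.2⟩ - ⟨u t, mem_domain t ht⟩))
      (𝓝 ⟨t, ht⟩) (𝓝 0)
  equation : ∀ (t : ℝ) (ht : 0 < t) (g : E.domain),
    inner ℝ (deriv u t) (g : Lp ℝ 2 μ) + E.form ⟨u t, mem_domain t ht⟩ g = 0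

/-- `T t = e^{-t𝓛}`, `t ≥ 0`, is the solution operator of the Cauchy problem of the form `E`, and
it is a symmetric Markov semigroup: it preserves positivity and is a contraction for the
`L^∞` norm. (The semigroup law, the symmetry of `T t` on `L²` and its contractivity on `L²` follow
from `solution`, since `E` is symmetric and nonnegative. Only `T t` for `t ≥ 0` matters.) -/
structure IsSymmetricMarkovSemigroup {X : Type*} [MeasurableSpace X] {μ : Measure X}
    (E : ClosedForm μ) (T : ℝ → Lp ℝ 2 μ →L[ℝ] Lp ℝ 2 μ) : Prop where
  solution : ∀ u₀ : Lp ℝ 2 μ, IsMildSolution E u₀ (fun t => T t u₀)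
  positivity : ∀ t : ℝ, 0 ≤ t → ∀ f : Lp ℝ 2 μ, 0 ≤ f → 0 ≤ T t f
  contraction : ∀ t : ℝ, 0 ≤ t → ∀ f : Lp ℝ 2 μ, eLpNorm (T t f) ⊤ μ ≤ eLpNorm f ⊤ μ

/-- `‖T t u₀‖_q ≤ B(t, q) ‖u₀‖₂` for all `2 ≤ q < ∞`, `t > 0` and `u₀ ∈ L²`, where `B ≥ 0`. -/
def SupercontractiveWith {X : Type*} [MeasurableSpace X] {μ : Measure X}
    (T : ℝ → Lp ℝ 2 μ →L[ℝ] Lp ℝ 2 μ) (B : ℝ → ℝ → ℝ) : Prop :=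
  ∀ q : ℝ, 2 ≤ q → ∀ t : ℝ, 0 < t → 0 ≤ B t q ∧ ∀ u₀ : Lp ℝ 2 μ,
    eLpNorm (T t u₀) (ENNReal.ofReal q) μ ≤ ENNReal.ofReal (B t q) * eLpNorm u₀ 2 μ

/-- Supercontractivity. -/
def IsSupercontractive {X : Type*} [MeasurableSpace X] {μ : Measure X}
    (T : ℝ → Lp ℝ 2 μ →L[ℝ] Lp ℝ 2 μ) : Prop :=
  ∃ B : ℝ → ℝ → ℝ, SupercontractiveWith T B

/-- `‖T t u₀‖_∞ ≤ B(t) ‖u₀‖₂` for all `t > 0` and `u₀ ∈ L²`, where `B ≥ 0`. -/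
def UltracontractiveWith {X : Type*} [MeasurableSpace X] {μ : Measure X}
    (T : ℝ → Lp ℝ 2 μ →L[ℝ] Lp ℝ 2 μ) (B : ℝ → ℝ) : Prop :=
  ∀ t : ℝ, 0 < t → 0 ≤ B t ∧ ∀ u₀ : Lp ℝ 2 μ,
    eLpNorm (T t u₀) ⊤ μ ≤ ENNReal.ofReal (B t) * eLpNorm u₀ 2 μ

/-- Ultracontractivity: supercontractivity with a bound `B(t, q)` such that
`B(t) = sup_{2 ≤ q < ∞} B(t, q)` is finite for every `t > 0`; in particular
`‖T t u₀‖_∞ ≤ B(t) ‖u₀‖₂`. -/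
def IsUltracontractive {X : Type*} [MeasurableSpace X] {μ : Measure X}
    (T : ℝ → Lp ℝ 2 μ →L[ℝ] Lp ℝ 2 μ) : Prop :=
  ∃ B : ℝ → ℝ → ℝ, SupercontractiveWith T B ∧
    (∀ t : ℝ, 0 < t → BddAbove (B t '' Ici 2)) ∧
    UltracontractiveWith T (fun t => sSup (B t '' Ici 2))

/-- The entropy `Ent(f) = ∫ Φ(|f|) - Φ(∫ |f|)`, with `Φ(s) = s log s`. -/
noncomputable def entropy {X : Type*} [MeasurableSpace X] (μ : Measure X) (f : X → ℝ) : ℝ :=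
  (∫ x, |f x| * Real.log |f x| ∂μ) - (∫ x, |f x| ∂μ) * Real.log (∫ x, |f x| ∂μ)

/-- The family of logarithmic Sobolev inequalities
`Ent(f²) ≤ 2 β(ε) ‖f‖₂² + 2 ε 𝓔(f, f)` for all `ε > 0` and `f ∈ L¹ ∩ H`.
For `f ∈ L¹ ∩ L²` the negative part of `f² log f²` is integrable, so the inequality includes the
integrability of `f² log f²`. -/
def LogSobolev {X : Type*} [MeasurableSpace X] {μ : Measure X} (E : ClosedForm μ)
    (β : ℝ → ℝ) : Prop :=
  ∀ ε : ℝ, 0 < ε → ∀ f : E.domain, MemLp (f : Lp ℝ 2 μ) 1 μ →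
    Integrable (fun x => (f : Lp ℝ 2 μ) x ^ 2 * Real.log ((f : Lp ℝ 2 μ) x ^ 2)) μ ∧
    entropy μ (fun x => (f : Lp ℝ 2 μ) x ^ 2) ≤
      2 * β ε * ‖(f : Lp ℝ 2 μ)‖ ^ 2 + 2 * ε * E.energy f

/-! Both directions differentiate a norm inequality along the semigroup.

From contractivity to log-Sobolev: duality turns `‖T t‖_{2→q} ≤ B` into a bound from `L^{q'}` to
`L²`, encoded by `SmoothingBound`. Interpolation with the trivial `L²` bound gives it at time `tδ`
with constant `B^{2δ}` and exponent `r = 2/(1+κδ)`, where `κ = 1 - 2/q` (`κ = 1` for `q = ∞`). Only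
`δ = 2^{-n}` is needed, so halving repeatedly (`SmoothingBound.half`) takes the place of complex
interpolation. Together with `‖f‖² - 2tδ 𝓔(f) ≤ ‖T (tδ) f‖²` this reads `‖f‖² - 2tδ 𝓔(f) ≤ B^{2δ} (∫
|f|^r)^{1+κδ}`, an equality at `δ = 0`. Comparing first-order terms as `δ → 0` gives the logarithmic
Sobolev inequality with `ε = t/κ`; Fatou's lemma provides the integrability of `f² log f²`
(`logSobolev_of_smoothingBound`).

From log-Sobolev to contractivity, this is Gross's argument. For bounded integrable `u₀ ≥ 0` let `u
= T s u₀`, let `p` solve `p' = 2(p-1)/ε`, and set `Z = ∫ u^p`. Log-Sobolev for `u^{p/2}` and the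
Stroock–Varopoulos inequality `𝓔(u^{p/2}) ≤ p²/(4(p-1)) ⟨-u', u^{p-1}⟩` make `(log Z + 2β(ε))/p`
nonincreasing (`hypercontractive_integral`). Moving from `p₀` to `p₁` thus costs time `(ε/2)
log((p₁-1)/(p₀-1))` and a factor `exp(2β(ε)(1/p₀ - 1/p₁))`. One move from 2 to `q` gives
supercontractivity. Infinitely many moves along `p_k = 1 + 2^k`, with `ε_k` in the `k`-th dyadic
subinterval of `(0, t]` chosen so that `β(ε_k)` is at most the average of `β⁺`, give
ultracontractivity with constant `exp((2/t) ∫₀ᵗ β⁺)`.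

The Markov property enters through level sets. On functions of a fixed simple function, `T t` acts
as a symmetric sub-Markov matrix (`exists_kernel`), so pointwise inequalities between real functions
pass to the approximate energies `⟨f - T h f, f⟩ / h`, and then to `𝓔` by `mem_domain_of_tendsto`.
-/

namespace IsSymmetricMarkovSemigroup

/-! ### Hilbert space theory: semigroup law, symmetry, and the energy as a derivative. -/

variable {X : Type*} [MeasurableSpace X] {μ : Measure X} {E : ClosedForm μ}
  {T : ℝ → Lp ℝ 2 μ →L[ℝ] Lp ℝ 2 μ}

/-- `T t f` as an element of the form domain, for `t > 0`. -/
noncomputable def smooth (hT : IsSymmetricMarkovSemigroup E T) {t : ℝ} (ht : 0 < t) (f : Lp ℝ 2 μ) : E.domain :=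
  ⟨T t f, (hT.solution f).mem_domain t ht⟩

@[simp] lemma coe_smooth (hT : IsSymmetricMarkovSemigroup E T) {t : ℝ} (ht : 0 < t)
    (f : Lp ℝ 2 μ) : (hT.smooth ht f : Lp ℝ 2 μ) = T t f := rfl

lemma apply_zero (hT : IsSymmetricMarkovSemigroup E T) (f : Lp ℝ 2 μ) : T 0 f = f :=
  (hT.solution f).initial

lemma hasDerivAt (hT : IsSymmetricMarkovSemigroup E T) {t : ℝ} (ht : 0 < t) (f : Lp ℝ 2 μ) :
    HasDerivAt (fun t => T t f) (deriv (fun t => T t f) t) t :=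
  (((hT.solution f).contDiffOn.differentiableOn one_ne_zero).differentiableAt
    (Ioi_mem_nhds ht)).hasDerivAt

lemma inner_deriv (hT : IsSymmetricMarkovSemigroup E T) {t : ℝ} (ht : 0 < t) (f : Lp ℝ 2 μ)
    (g : E.domain) :
    inner ℝ (deriv (fun t => T t f) t) (g : Lp ℝ 2 μ) = -E.form (hT.smooth ht f) g := by
  have := (hT.solution f).equation t ht g
  unfold smooth
  linarith

/-- The pairing `⟨T (t+r) f, T (s-r) g⟩` has derivative `-𝓔 + 𝓔 = 0` in `r` by symmetry of the form,
so its values at `r = 0` and `r = s` agree. Symmetry of `T t` and the semigroup law both follow. -/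
lemma inner_apply_add (hT : IsSymmetricMarkovSemigroup E T) {t s : ℝ} (ht : 0 ≤ t) (hs : 0 ≤ s)
    (f g : Lp ℝ 2 μ) : inner ℝ (T (t + s) f) g = inner ℝ (T t f) (T s g) := by
  rcases hs.eq_or_lt with rfl | hs
  · simp [hT.apply_zero]
  have hc : ContinuousOn (fun r => inner ℝ (T (t + r) f) (T (s - r) g)) (Icc 0 s) := by
    apply ContinuousOn.inner
    · exact (hT.solution f).continuousOn.comp (f := fun r => t + r) (by fun_prop)
        (fun r hr => by simp only [mem_Ici]; linarith [hr.1])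
    · exact (hT.solution g).continuousOn.comp (f := fun r => s - r) (by fun_prop)
        (fun r hr => by simp only [mem_Ici]; linarith [hr.2])
  have hd : ∀ r ∈ Ioo 0 s,
      HasDerivAt (fun r => inner ℝ (T (t + r) f) (T (s - r) g)) 0 r := by
    intro r hr
    have h1 : 0 < t + r := by linarith [hr.1]
    have h2 : 0 < s - r := by linarith [hr.2]
    have d1 : HasDerivAt (fun r => T (t + r) f) _ r := (hT.hasDerivAt h1 f).comp_const_add t r
    have d2 : HasDerivAt (fun r => T (s - r) g) _ r := (hT.hasDerivAt h2 g).comp_const_sub s r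
    have d := d1.inner ℝ d2
    have e1 := hT.inner_deriv h1 f (hT.smooth h2 g)
    have e2 := hT.inner_deriv h2 g (hT.smooth h1 f)
    rw [coe_smooth] at e1 e2
    refine d.congr_deriv ?_
    rw [inner_neg_right, real_inner_comm, e1, e2, E.symm (hT.smooth h1 f)]
    ring
  obtain ⟨c, -, hc⟩ := exists_hasDerivAt_eq_slope _ _ hs hc hd
  rw [eq_comm, div_eq_zero_iff] at hc
  rcases hc with hc | hc
  · simpa [sub_eq_zero, hT.apply_zero] using hc
  · linarith

lemma inner_apply_comm (hT : IsSymmetricMarkovSemigroup E T) {t : ℝ} (ht : 0 ≤ t)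
    (f g : Lp ℝ 2 μ) : inner ℝ (T t f) g = inner ℝ f (T t g) := by
  simpa [hT.apply_zero] using hT.inner_apply_add le_rfl ht f g

lemma apply_add (hT : IsSymmetricMarkovSemigroup E T) {t s : ℝ} (ht : 0 ≤ t) (hs : 0 ≤ s)
    (f : Lp ℝ 2 μ) : T (t + s) f = T s (T t f) := by
  refine ext_inner_right ℝ fun g => ?_
  rw [hT.inner_apply_add ht hs, hT.inner_apply_comm hs]

lemma hasDerivAt_inner (hT : IsSymmetricMarkovSemigroup E T) {t : ℝ} (ht : 0 < t)
    (f g : Lp ℝ 2 μ) :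
    HasDerivAt (fun t => inner ℝ (T t f) g) (inner ℝ (deriv (fun t => T t f) t) g) t := by
  simpa using (hT.hasDerivAt ht f).inner ℝ (hasDerivAt_const t g)

/-- Near `a + b` the function is `⟨T (r-b) f, T b f⟩`, and `T b f` is an admissible test function.
Hence `𝓔(T a f, T b f)` depends only on `a + b`. -/
lemma hasDerivAt_inner_self (hT : IsSymmetricMarkovSemigroup E T) {a b : ℝ} (ha : 0 < a)
    (hb : 0 < b) (f : Lp ℝ 2 μ) :
    HasDerivAt (fun t => inner ℝ (T t f) f) (-E.form (hT.smooth ha f) (hT.smooth hb f))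
      (a + b) := by
  have h := hT.hasDerivAt_inner ha f (T b f)
  have e := hT.inner_deriv ha f (hT.smooth hb f)
  rw [coe_smooth] at e
  rw [e] at h
  have h' := HasDerivAt.comp_sub_const (a + b) b (by rwa [add_sub_cancel_right])
  refine h'.congr_of_eventuallyEq ?_
  filter_upwards [Ioi_mem_nhds (show b < a + b by linarith)] with r hr
  rw [← hT.inner_apply_add (sub_nonneg.2 (le_of_lt hr)) hb.le, sub_add_cancel]

lemma form_smooth_eq (hT : IsSymmetricMarkovSemigroup E T) {a b c d : ℝ} (ha : 0 < a)
    (hb : 0 < b) (hc : 0 < c) (hd : 0 < d) (h : a + b = c + d) (f : Lp ℝ 2 μ) :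
    E.form (hT.smooth ha f) (hT.smooth hb f) = E.form (hT.smooth hc f) (hT.smooth hd f) := by
  have h1 := hT.hasDerivAt_inner_self ha hb f
  have h2 := hT.hasDerivAt_inner_self hc hd f
  rw [h] at h1
  linarith [h1.unique h2]

lemma norm_apply_le (hT : IsSymmetricMarkovSemigroup E T) {t : ℝ} (ht : 0 ≤ t)
    (f : Lp ℝ 2 μ) : ‖T t f‖ ≤ ‖f‖ := by
  have h : AntitoneOn (fun t => ‖T t f‖ ^ 2) (Ici 0) := by
    refine antitoneOn_of_hasDerivWithinAt_nonpos (convex_Ici 0)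
      (f' := fun t => 2 * inner ℝ (T t f) (deriv (fun t => T t f) t))
      ((hT.solution f).continuousOn.norm.pow 2) ?_ ?_
    · intro x hx
      rw [interior_Ici] at hx
      exact ((hT.hasDerivAt hx f).norm_sq).hasDerivWithinAt
    · intro x hx
      rw [interior_Ici] at hx
      have e := hT.inner_deriv hx f (hT.smooth hx f)
      replace e : inner ℝ (deriv (fun t => T t f) x) (T x f) = _ := e
      rw [real_inner_comm, e]
      linarith [E.nonneg (hT.smooth hx f)]
  have h2 : ‖T t f‖ ^ 2 ≤ ‖T 0 f‖ ^ 2 := h (mem_Ici.2 le_rfl) ht ht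
  rw [hT.apply_zero] at h2
  exact (sq_le_sq₀ (norm_nonneg _) (norm_nonneg _)).1 h2

/-- `t ↦ ⟨T t f, f⟩` is midpoint convex. -/
lemma inner_sub_antitone (hT : IsSymmetricMarkovSemigroup E T) {s h : ℝ} (hs : 0 ≤ s)
    (hh : 0 ≤ h) (f : Lp ℝ 2 μ) (n : ℕ) :
    inner ℝ (T (s + n * h) f) f - inner ℝ (T (s + n * h + h) f) f ≤
      inner ℝ (T s f) f - inner ℝ (T (s + h) f) f := by
  induction n with
  | zero => simp
  | succ n ih =>
    refine le_trans ?_ ih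
    set r := s + n * h with hr
    have hr0 : 0 ≤ r / 2 := by positivity
    rw [show s + ((n + 1 : ℕ) : ℝ) * h = r + h by push_cast; ring]
    -- Expanded by the semigroup law, this square is the second difference of `t ↦ ⟨T t f, f⟩` over
    -- `r`, `r + h`, `r + 2h`.
    have h0 : 0 ≤ ‖T (r / 2) f - T (r / 2 + h) f‖ ^ 2 := by positivity
    rw [norm_sub_sq_real, ← real_inner_self_eq_norm_sq, ← real_inner_self_eq_norm_sq,
      ← hT.inner_apply_add hr0 hr0, ← hT.inner_apply_add hr0 (by positivity),
      ← hT.inner_apply_add (by positivity) (by positivity)] at h0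
    rw [show r / 2 + r / 2 = r by ring, show r / 2 + (r / 2 + h) = r + h by ring,
      show r / 2 + h + (r / 2 + h) = r + h + h by ring] at h0
    linarith

lemma tendsto_slope (hT : IsSymmetricMarkovSemigroup E T) {b : ℝ} (hb : 0 < b)
    (f g : Lp ℝ 2 μ) {h : ℕ → ℝ} (hpos : ∀ n, 0 < h n) (hlim : Tendsto h atTop (𝓝 0)) :
    Tendsto (fun n => (inner ℝ (T b f) g - inner ℝ (T (b + h n) f) g) / h n) atTop
      (𝓝 (-inner ℝ (deriv (fun t => T t f) b) g)) := by
  have hd := (hT.hasDerivAt_inner hb f g).tendsto_slope_zero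
  have : Tendsto h atTop (𝓝[≠] 0) :=
    tendsto_nhdsWithin_iff.2 ⟨hlim, Eventually.of_forall fun n => (hpos n).ne'⟩
  refine ((hd.comp this).neg).congr fun n => ?_
  simp only [Function.comp, smul_eq_mul]
  rw [← mul_neg, neg_sub, div_eq_inv_mul]

lemma tendsto_div_succ (d : ℝ) : Tendsto (fun n : ℕ => d / ((n : ℝ) + 1)) atTop (𝓝 0) := by
  simpa [div_eq_mul_inv] using (tendsto_one_div_add_atTop_nhds_zero_nat (𝕜 := ℝ)).const_mul d

/-- The two energies are minus the slopes of the convex function `t ↦ ⟨T t f, f⟩` at `c + d` and `a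
+ b`. Dividing the gap into `n + 1` equal steps compares difference quotients at its ends by
midpoint convexity alone. -/
lemma form_smooth_antitone (hT : IsSymmetricMarkovSemigroup E T) {a b c d : ℝ} (ha : 0 < a)
    (hb : 0 < b) (hc : 0 < c) (hd : 0 < d) (h : a + b ≤ c + d) (f : Lp ℝ 2 μ) :
    E.form (hT.smooth hc f) (hT.smooth hd f) ≤ E.form (hT.smooth ha f) (hT.smooth hb f) := by
  rcases h.eq_or_lt with h | h
  · exact (hT.form_smooth_eq ha hb hc hd h f).ge
  have hab : 0 < a + b := by positivity
  have hcd : 0 < c + d := by positivity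
  have hpos : ∀ n : ℕ, 0 < (c + d - (a + b)) / ((n : ℝ) + 1) := fun n =>
    div_pos (by linarith) (by positivity)
  have l1 := hT.tendsto_slope hab f f hpos (tendsto_div_succ _)
  have l2 := hT.tendsto_slope hcd f f hpos (tendsto_div_succ _)
  rw [(hT.hasDerivAt_inner hab f f).unique (hT.hasDerivAt_inner_self ha hb f), neg_neg] at l1
  rw [(hT.hasDerivAt_inner hcd f f).unique (hT.hasDerivAt_inner_self hc hd f), neg_neg] at l2
  refine le_of_tendsto_of_tendsto' l2 l1 fun n => ?_
  have := hT.inner_sub_antitone hab.le (hpos n).le f (n + 1)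
  rw [show a + b + ((n + 1 : ℕ) : ℝ) * ((c + d - (a + b)) / ((n : ℝ) + 1)) = c + d by
    push_cast; field_simp; ring] at this
  exact div_le_div_of_nonneg_right this (hpos n).le

/-- The energy bounds the decay of `⟨T t g, g⟩`. -/
lemma norm_sq_sub_le_inner (hT : IsSymmetricMarkovSemigroup E T) {s : ℝ} (hs : 0 ≤ s)
    (g : E.domain) :
    ‖(g : Lp ℝ 2 μ)‖ ^ 2 - s * E.energy g ≤ inner ℝ (T s (g : Lp ℝ 2 μ)) (g : Lp ℝ 2 μ) := by
  rcases hs.eq_or_lt with rfl | hs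
  · simp [hT.apply_zero]
  have hc : ContinuousOn (fun r => inner ℝ (T r (g : Lp ℝ 2 μ)) (g : Lp ℝ 2 μ)) (Icc 0 s) :=
    (((hT.solution (g : Lp ℝ 2 μ)).continuousOn).mono Icc_subset_Ici_self).inner
      continuousOn_const
  obtain ⟨c, hc, hcs⟩ := exists_hasDerivAt_eq_slope _ _ hs hc
    (fun x hx => hT.hasDerivAt_inner hx.1 (g : Lp ℝ 2 μ) (g : Lp ℝ 2 μ))
  have hc0 : 0 < c := hc.1
  have hc2 : 0 < c / 2 := by positivity
  have h1 : E.form (hT.smooth hc0 (g : Lp ℝ 2 μ)) g =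
      E.form (hT.smooth hc2 (g : Lp ℝ 2 μ)) (hT.smooth hc2 (g : Lp ℝ 2 μ)) := by
    have := (hT.hasDerivAt_inner hc0 (g : Lp ℝ 2 μ) (g : Lp ℝ 2 μ))
    have h2 := hT.hasDerivAt_inner_self hc2 hc2 (g : Lp ℝ 2 μ)
    rw [add_halves] at h2
    have h3 := this.unique h2
    rw [hT.inner_deriv hc0 _ g] at h3
    linarith
  have h2 := hT.form_smooth_antitone hc2 hc2 hc0 hc0 (by linarith) (g : Lp ℝ 2 μ)
  -- This gives `2 𝓔(T c g, g) ≤ 𝓔(g) + 𝓔(T c g)`, and the last term is at most `𝓔(T (c/2) g) = 𝓔(T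
  -- c g, g)`.
  have h3 := E.nonneg (g - hT.smooth hc0 (g : Lp ℝ 2 μ))
  simp only [map_sub, LinearMap.sub_apply] at h3
  rw [E.symm g (hT.smooth hc0 _)] at h3
  have h4 : E.form (hT.smooth hc0 (g : Lp ℝ 2 μ)) g ≤ E.energy g := by
    unfold ClosedForm.energy
    linarith
  rw [hT.inner_deriv hc0 _ g, sub_zero, eq_div_iff hs.ne', hT.apply_zero,
    real_inner_self_eq_norm_sq] at hcs
  nlinarith

/-- A function whose approximate energies `⟨f - T h f, f⟩ / h` have a finite bound as `h → 0`
belongs to the form domain. -/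
lemma mem_domain_of_tendsto (hT : IsSymmetricMarkovSemigroup E T) (f : Lp ℝ 2 μ) (R : ℝ → ℝ)
    (C : ℝ) (hR : ∀ h, 0 < h → (inner ℝ f f - inner ℝ (T h f) f) / h ≤ R h)
    (hlim : ∀ h : ℕ → ℝ, (∀ n, 0 < h n) → Tendsto h atTop (𝓝 0) →
      Tendsto (fun n => R (h n)) atTop (𝓝 C)) :
    ∃ hf : f ∈ E.domain, E.energy ⟨f, hf⟩ ≤ C := by
  -- `𝓔(T s f)` is minus the slope at `2s`; by convexity the quotients there are at most those at
  -- `0`, which `R` bounds.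
  have bound : ∀ s (hs : 0 < s), E.form (hT.smooth hs f) (hT.smooth hs f) ≤ C := by
    intro s hs
    have hs2 : 0 < s + s := by positivity
    have hpos : ∀ n : ℕ, 0 < (s + s) / ((n : ℝ) + 1) := fun n => by positivity
    have l1 := hT.tendsto_slope hs2 f f hpos (tendsto_div_succ _)
    rw [(hT.hasDerivAt_inner hs2 f f).unique (hT.hasDerivAt_inner_self hs hs f), neg_neg] at l1
    refine le_of_tendsto_of_tendsto' l1 (hlim _ hpos (tendsto_div_succ _)) fun n => ?_
    refine le_trans (div_le_div_of_nonneg_right ?_ (hpos n).le) (hR _ (hpos n))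
    have := hT.inner_sub_antitone le_rfl (hpos n).le f (n + 1)
    rw [show 0 + ((n + 1 : ℕ) : ℝ) * ((s + s) / ((n : ℝ) + 1)) = s + s by
      push_cast; field_simp; ring, zero_add, hT.apply_zero] at this
    exact this
  have hs : ∀ n : ℕ, 0 < 1 / ((n : ℝ) + 1) := fun n => by positivity
  set u : ℕ → E.domain := fun n => hT.smooth (hs n) f with hu
  set e : ℕ → ℝ := fun n => E.form (u n) (u n) with he
  have hsmono : ∀ {n m : ℕ}, n ≤ m → 1 / ((m : ℝ) + 1) ≤ 1 / ((n : ℝ) + 1) := fun {n m} h =>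
    one_div_le_one_div_of_le (by positivity) (by simpa using h)
  have hmono : Monotone e := fun n m h => hT.form_smooth_antitone (hs m) (hs m) (hs n) (hs n)
    (by linarith [hsmono h]) f
  have hbdd : BddAbove (range e) := ⟨C, by rintro _ ⟨n, rfl⟩; exact bound _ (hs n)⟩
  have hcau := (tendsto_atTop_ciSup hmono hbdd).cauchySeq
  -- Since `u n` has run longer, `𝓔(u n, u m) ≥ 𝓔(u n, u n)`, so the cross term is controlled. The
  -- energies increase to a finite limit, hence `u` is Cauchy for the form.
  have hdiff : ∀ n m, n ≤ m → E.form (u n - u m) (u n - u m) ≤ e m - e n := by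
    intro n m h
    have := hT.form_smooth_antitone (hs n) (hs m) (hs n) (hs n) (by linarith [hsmono h]) f
    simp only [map_sub, LinearMap.sub_apply]
    rw [E.symm (u m) (u n)]
    simp only [he]
    linarith
  have hdiff' : ∀ n m, E.form (u n - u m) (u n - u m) ≤ dist (e n) (e m) := by
    intro n m
    rcases le_total n m with h | h
    · rw [dist_comm]
      exact (hdiff n m h).trans (le_abs_self _)
    · rw [← neg_sub (u m), map_neg, map_neg, LinearMap.neg_apply, neg_neg]
      exact (hdiff m n h).trans (le_abs_self _)
  have hconv : Tendsto (fun n => (u n : Lp ℝ 2 μ)) atTop (𝓝 f) := by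
    have h0 := (hT.solution f).continuousOn 0 (mem_Ici.2 le_rfl)
    have h1 : Tendsto (fun n : ℕ => 1 / ((n : ℝ) + 1)) atTop (𝓝[Ici 0] 0) :=
      tendsto_nhdsWithin_iff.2 ⟨tendsto_one_div_add_atTop_nhds_zero_nat,
        Eventually.of_forall fun n => (hs n).le⟩
    have h2 := h0.tendsto.comp h1
    rw [hT.apply_zero] at h2
    exact h2
  obtain ⟨hf, hE⟩ := E.closed u f hconv (squeeze_zero (fun k => E.nonneg _)
    (fun k => hdiff' k.1 k.2) (by
      rw [cauchySeq_iff_tendsto_dist_atTop_0] at hcau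
      exact hcau))
  refine ⟨hf, ?_⟩
  -- Weighted Cauchy–Schwarz: `𝓔(f) ≤ (1+η) 𝓔(u n) + (1+η⁻¹) 𝓔(u n - f)`; let `n → ∞`, then `η → 0`.
  have key : ∀ η : ℝ, 0 < η → E.energy ⟨f, hf⟩ ≤ (1 + η) * C := by
    intro η hη
    have hl : Tendsto (fun n => (1 + η) * C + (1 + η⁻¹) *
        E.form (u n - ⟨f, hf⟩) (u n - ⟨f, hf⟩)) atTop (𝓝 ((1 + η) * C + (1 + η⁻¹) * 0)) :=
      (hE.const_mul _).const_add _
    rw [mul_zero, add_zero] at hl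
    refine ge_of_tendsto' hl fun n => ?_
    have h1 := E.nonneg (η • u n + (u n - ⟨f, hf⟩))
    have h2 : E.energy ⟨f, hf⟩ = E.form (u n - (u n - ⟨f, hf⟩)) (u n - (u n - ⟨f, hf⟩)) := by
      simp [ClosedForm.energy]
    rw [h2]
    have h3 := bound _ (hs n)
    change E.form (u n) (u n) ≤ C at h3
    generalize u n - ⟨f, hf⟩ = w at *
    simp only [map_sub, map_add, map_smul, LinearMap.sub_apply, LinearMap.add_apply,
      LinearMap.smul_apply, smul_eq_mul] at h1 ⊢
    rw [E.symm w (u n)] at h1 ⊢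
    have h4 : 0 ≤ η * E.form (u n) (u n) + 2 * E.form (u n) w + η⁻¹ * E.form w w := by
      have := mul_nonneg (inv_pos.2 hη).le h1
      field_simp at this ⊢
      linarith
    nlinarith
  refine le_of_forall_pos_le_add fun δ hδ => ?_
  have h0 : 0 ≤ E.energy ⟨f, hf⟩ := E.nonneg _
  have hC : 0 ≤ C := (E.nonneg _).trans (bound 1 one_pos)
  have := key (δ / (C + 1)) (by positivity)
  have h2 : δ / (C + 1) * C ≤ δ := by
    rw [div_mul_eq_mul_div, div_le_iff₀ (by positivity)]
    nlinarith
  linarith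

end IsSymmetricMarkovSemigroup

/-! ### Simple functions and their level sets. -/

section SimpleFunctions

variable {X : Type*} [MeasurableSpace X] {μ : Measure X}

lemma MeasureTheory.SimpleFunc.memLp_two_map {s : SimpleFunc X ℝ} (hs : MemLp s 2 μ) {φ : ℝ → ℝ}
    (hφ : φ 0 = 0) : MemLp (s.map φ) 2 μ := by
  rw [SimpleFunc.memLp_iff_finMeasSupp two_ne_zero ENNReal.ofNat_ne_top] at hs ⊢
  exact hs.map hφ

/-- A square integrable simple function and its images under functions vanishing at zero are
combinations of the indicators `e y` of its level sets. -/
lemma MeasureTheory.SimpleFunc.exists_level_decomposition {s : SimpleFunc X ℝ}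
    (hs : MemLp s 2 μ) :
    ∃ e : ℝ → Lp ℝ 2 μ, e 0 = 0 ∧ (∀ y, 0 ≤ e y) ∧ (∀ y z, y ≠ z → inner ℝ (e y) (e z) = 0) ∧
      (∀ y, ∀ g : Lp ℝ 2 μ, (∀ᵐ x ∂μ, g x ≤ 1) → inner ℝ (e y) g ≤ inner ℝ (e y) (e y)) ∧
      ∀ (φ : ℝ → ℝ) (hφ : φ 0 = 0),
        (SimpleFunc.memLp_two_map hs hφ).toLp = ∑ y ∈ s.range, φ y • e y := by
  have hA : ∀ y : ℝ, MeasurableSet (s ⁻¹' ({y} \ {0})) := fun y => s.measurableSet_preimage _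
  have hμ : ∀ y : ℝ, μ (s ⁻¹' ({y} \ {0})) ≠ ⊤ := by
    intro y
    by_cases hy : y = 0
    · simp [hy]
    · exact ((measure_mono (preimage_mono sdiff_subset)).trans_lt
        (SimpleFunc.measure_preimage_lt_top_of_memLp two_ne_zero ENNReal.ofNat_ne_top s hs y
          hy)).ne
  refine ⟨fun y => indicatorConstLp 2 (hA y) (hμ y) 1, ?_, ?_, ?_, ?_, ?_⟩
  · simp
  · intro y
    rw [← Lp.coeFn_nonneg]
    filter_upwards [indicatorConstLp_coeFn (p := 2) (hs := hA y) (hμs := hμ y) (c := (1 : ℝ))]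
      with x hx
    rw [hx]
    exact indicator_nonneg (fun _ _ => zero_le_one) _
  · intro y z hyz
    rw [L2.inner_indicatorConstLp_one]
    refine (setIntegral_congr_ae (g := fun _ => (0 : ℝ)) (hA y) ?_).trans (by simp)
    filter_upwards [indicatorConstLp_coeFn (p := 2) (hs := hA z) (hμs := hμ z) (c := (1 : ℝ))]
      with x hx hxy
    rw [hx, indicator_of_notMem]
    intro hxz
    exact hyz (hxy.1.symm.trans hxz.1)
  · intro y g hg
    rw [L2.inner_indicatorConstLp_one, L2.inner_indicatorConstLp_one]
    refine setIntegral_mono_on_ae (integrableOn_Lp_of_measure_ne_top _ (by norm_num) (hμ y))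
      (integrableOn_Lp_of_measure_ne_top _ (by norm_num) (hμ y)) (hA y) ?_
    filter_upwards [hg,
      indicatorConstLp_coeFn (p := 2) (hs := hA y) (hμs := hμ y) (c := (1 : ℝ))] with x hx hx' hxA
    rw [hx', indicator_of_mem hxA]
    exact hx
  · intro φ hφ
    refine Lp.ext ?_
    have h1 := Lp.coeFn_fun_finsetSum (p := 2) (μ := μ) s.range
      (fun y => φ y • indicatorConstLp 2 (hA y) (hμ y) (1 : ℝ))
    have h2 : ∀ᵐ x ∂μ, ∀ y ∈ s.range, (φ y • indicatorConstLp 2 (hA y) (hμ y) (1 : ℝ) :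
        Lp ℝ 2 μ) x = φ y * (s ⁻¹' ({y} \ {0})).indicator (fun _ => (1 : ℝ)) x := by
      refine (ae_ball_iff (Finset.countable_toSet s.range)).2 ?_
      intro y _
      filter_upwards [Lp.coeFn_smul (φ y) (indicatorConstLp 2 (hA y) (hμ y) (1 : ℝ)),
        indicatorConstLp_coeFn (p := 2) (hs := hA y) (hμs := hμ y) (c := (1 : ℝ))] with x h h'
      rw [h, Pi.smul_apply, h', smul_eq_mul]
    filter_upwards [h1, h2, (SimpleFunc.memLp_two_map hs hφ).coeFn_toLp] with x h1 h2 h3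
    rw [h3, h1, Finset.sum_congr rfl h2, Finset.sum_eq_single (s x)]
    · by_cases h : s x = 0
      · simp [h, hφ]
      · rw [indicator_of_mem (by simp [h])]
        simp
    · intro y _ hy
      rw [indicator_of_notMem, mul_zero]
      rintro ⟨h, -⟩
      exact hy h.symm
    · intro h
      exact absurd (SimpleFunc.mem_range_self s x) h

lemma exists_simpleFunc_nonneg_tendsto (f : Lp ℝ 2 μ) (hf : 0 ≤ f) :
    ∃ (s : ℕ → SimpleFunc X ℝ) (hs : ∀ n, MemLp (s n) 2 μ), (∀ n x, 0 ≤ s n x) ∧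
      (∀ n, ∀ᵐ x ∂μ, s n x ≤ 2 * f x) ∧
      (∀ᵐ x ∂μ, Tendsto (fun n => s n x) atTop (𝓝 (f x))) ∧
      Tendsto (fun n => (hs n).toLp) atTop (𝓝 f) := by
  have hm : Measurable f := (Lp.stronglyMeasurable f).measurable
  have hf' := (Lp.coeFn_nonneg f).2 hf
  have hcl : ∀ᵐ x ∂μ, f x ∈ closure (Ici (0 : ℝ)) := by
    filter_upwards [hf'] with x hx
    rw [isClosed_Ici.closure_eq]
    exact hx
  set s : ℕ → SimpleFunc X ℝ := fun n => SimpleFunc.approxOn f hm (Ici 0) 0 self_mem_Ici n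
  have hs : ∀ n, MemLp (s n) 2 μ :=
    fun n => SimpleFunc.memLp_approxOn hm (Lp.memLp f) self_mem_Ici MemLp.zero' n
  refine ⟨s, hs, fun n x => SimpleFunc.approxOn_mem hm self_mem_Ici n x, ?_, ?_, ?_⟩
  · intro n
    filter_upwards [hf'] with x hx
    have := SimpleFunc.norm_approxOn_zero_le hm self_mem_Ici x n
    rw [Real.norm_of_nonneg hx] at this
    linarith [Real.le_norm_self (s n x)]
  · filter_upwards [hcl] with x hx
    exact SimpleFunc.tendsto_approxOn hm self_mem_Ici hx
  · rw [Lp.tendsto_Lp_iff_tendsto_eLpNorm']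
    have := SimpleFunc.tendsto_approxOn_Lp_eLpNorm hm self_mem_Ici (p := 2)
      ENNReal.ofNat_ne_top hcl (by simpa using (Lp.memLp f).2)
    refine this.congr fun n => eLpNorm_congr_ae ?_
    filter_upwards [(hs n).coeFn_toLp] with x hx
    simp only [Pi.sub_apply, hx]
    rfl

end SimpleFunctions

/-! ### Inequalities for symmetric sub-Markov matrices. -/

section FiniteSums

variable {ι : Finset ℝ} {w : ℝ → ℝ} {m : ℝ → ℝ → ℝ}

/-- The left side equals `½ ∑ m (φ y - φ z)² + ∑ (w y - ∑ m) φ(y)²`, and the right side has the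
analogous form. All weights are nonnegative, so the hypothesis on `φ, ψ` compares them term by term,
with `b = 0` for the killing part. -/
lemma sum_energy_le (hm : ∀ y z, 0 ≤ m y z) (hsymm : ∀ y z, m y z = m z y)
    (hw : ∀ y, ∑ z ∈ ι, m y z ≤ w y) {φ ψ : ℝ → ℝ} (hφ : φ 0 = 0) (hψ : ψ 0 = 0)
    (h : ∀ a b, (φ a - φ b) ^ 2 ≤ (a - b) * (ψ a - ψ b)) :
    ∑ y ∈ ι, φ y * φ y * w y - ∑ y ∈ ι, ∑ z ∈ ι, φ y * φ z * m y z ≤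
      ∑ y ∈ ι, y * ψ y * w y - ∑ y ∈ ι, ∑ z ∈ ι, y * ψ z * m y z := by
  have h0 : ∀ a, 0 ≤ a * ψ a - φ a * φ a := fun a => by
    have := h a 0
    rw [hφ, hψ] at this
    nlinarith
  have h1 : 0 ≤ ∑ y ∈ ι, (w y - ∑ z ∈ ι, m y z) * (y * ψ y - φ y * φ y) :=
    Finset.sum_nonneg fun y _ => mul_nonneg (sub_nonneg.2 (hw y)) (h0 y)
  have h2 : 0 ≤ ∑ y ∈ ι, ∑ z ∈ ι, m y z * ((y - z) * (ψ y - ψ z) - (φ y - φ z) ^ 2) :=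
    Finset.sum_nonneg fun y _ => Finset.sum_nonneg fun z _ =>
      mul_nonneg (hm y z) (sub_nonneg.2 (h y z))
  have h3 : ∑ y ∈ ι, ∑ z ∈ ι, m y z * ((y - z) * (ψ y - ψ z) - (φ y - φ z) ^ 2) =
      ∑ y ∈ ι, ∑ z ∈ ι, m y z * (y * ψ y - φ y * φ y) +
      ∑ y ∈ ι, ∑ z ∈ ι, m y z * (z * ψ z - φ z * φ z) +
      2 * ∑ y ∈ ι, ∑ z ∈ ι, φ y * φ z * m y z - ∑ y ∈ ι, ∑ z ∈ ι, y * ψ z * m y z -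
      ∑ y ∈ ι, ∑ z ∈ ι, z * ψ y * m y z := by
    simp only [Finset.mul_sum, ← Finset.sum_add_distrib, ← Finset.sum_sub_distrib]
    refine Finset.sum_congr rfl fun y _ => Finset.sum_congr rfl fun z _ => by ring
  have h4 : ∑ y ∈ ι, ∑ z ∈ ι, m y z * (z * ψ z - φ z * φ z) =
      ∑ y ∈ ι, ∑ z ∈ ι, m y z * (y * ψ y - φ y * φ y) := by
    rw [Finset.sum_comm]
    refine Finset.sum_congr rfl fun y _ => Finset.sum_congr rfl fun z _ => by rw [hsymm]
  have h5 : ∑ y ∈ ι, ∑ z ∈ ι, z * ψ y * m y z = ∑ y ∈ ι, ∑ z ∈ ι, y * ψ z * m y z := by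
    rw [Finset.sum_comm]
    refine Finset.sum_congr rfl fun y _ => Finset.sum_congr rfl fun z _ => by rw [hsymm]
  have h6 : ∑ y ∈ ι, (w y - ∑ z ∈ ι, m y z) * (y * ψ y - φ y * φ y) =
      ∑ y ∈ ι, y * ψ y * w y - ∑ y ∈ ι, φ y * φ y * w y -
      ∑ y ∈ ι, ∑ z ∈ ι, m y z * (y * ψ y - φ y * φ y) := by
    simp only [← Finset.sum_mul, ← Finset.sum_sub_distrib]
    refine Finset.sum_congr rfl fun y _ => by ring
  linarith

/-- By the arithmetic–geometric mean inequality `2yz ≤ u(y)v(z) + u(z)v(y)`, as the product of the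
two terms is `(yz)²`; then symmetrize. This is the discrete core of the interpolation. -/
lemma sum_mul_le_of_sq_eq (hm : ∀ y z, 0 ≤ m y z) (hsymm : ∀ y z, m y z = m z y) {u v : ℝ → ℝ}
    (hu : ∀ y ∈ ι, 0 ≤ u y) (hv : ∀ y ∈ ι, 0 ≤ v y) (huv : ∀ y ∈ ι, u y * v y = y ^ 2) :
    ∑ y ∈ ι, ∑ z ∈ ι, y * z * m y z ≤ ∑ y ∈ ι, ∑ z ∈ ι, u y * v z * m y z := by
  have h1 : ∑ y ∈ ι, ∑ z ∈ ι, 2 * (y * z * m y z) ≤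
      ∑ y ∈ ι, ∑ z ∈ ι, (u y * v z * m y z + u z * v y * m y z) := by
    refine Finset.sum_le_sum fun y hy => Finset.sum_le_sum fun z hz => ?_
    have h2 : 2 * (y * z) ≤ u y * v z + u z * v y := by
      refine le_of_abs_le (abs_le_of_sq_le_sq ?_ (add_nonneg (mul_nonneg (hu y hy) (hv z hz))
        (mul_nonneg (hu z hz) (hv y hy))))
      have : (y * z) ^ 2 = (u y * v z) * (u z * v y) := by
        rw [mul_pow, ← huv y hy, ← huv z hz]; ring
      nlinarith [sq_nonneg (u y * v z - u z * v y)]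
    nlinarith [hm y z]
  have h2 : ∑ y ∈ ι, ∑ z ∈ ι, u z * v y * m y z = ∑ y ∈ ι, ∑ z ∈ ι, u y * v z * m y z := by
    rw [Finset.sum_comm]
    refine Finset.sum_congr rfl fun y _ => Finset.sum_congr rfl fun z _ => by rw [hsymm]
  simp only [Finset.sum_add_distrib, ← Finset.mul_sum] at h1
  linarith

end FiniteSums

/-! ### Markov operators as matrices on level sets. -/

namespace IsSymmetricMarkovSemigroup

variable {X : Type*} [MeasurableSpace X] {μ : Measure X} {E : ClosedForm μ}
  {T : ℝ → Lp ℝ 2 μ →L[ℝ] Lp ℝ 2 μ}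

lemma abs_apply_le (hT : IsSymmetricMarkovSemigroup E T) {t : ℝ} (ht : 0 ≤ t) (f : Lp ℝ 2 μ) :
    |T t f| ≤ T t |f| := by
  have h1 := hT.positivity t ht (|f| - f) (sub_nonneg.2 (le_abs_self f))
  have h2 := hT.positivity t ht (|f| + f) (neg_le_iff_add_nonneg.1 (neg_le_abs f))
  rw [map_sub, sub_nonneg] at h1
  rw [map_add] at h2
  exact abs_le'.2 ⟨h1, neg_le_iff_add_nonneg.2 h2⟩

lemma ae_abs_apply_le (hT : IsSymmetricMarkovSemigroup E T) {t : ℝ} (ht : 0 ≤ t) {f : Lp ℝ 2 μ}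
    {M : ℝ} (hM : 0 ≤ M) (hf : ∀ᵐ x ∂μ, |f x| ≤ M) : ∀ᵐ x ∂μ, |T t f x| ≤ M := by
  have h : eLpNorm f ⊤ μ ≤ ENNReal.ofReal M := by
    rw [eLpNorm_exponent_top]
    exact eLpNormEssSup_le_of_ae_bound hf
  have h2 := (hT.contraction t ht f).trans h
  rw [eLpNorm_exponent_top] at h2
  filter_upwards [ae_le_eLpNormEssSup (f := T t f) (μ := μ)] with x hx
  have h3 := hx.trans h2
  rwa [← ofReal_norm, ENNReal.ofReal_le_ofReal_iff hM] at h3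

lemma inner_nonneg_of_nonneg {f g : Lp ℝ 2 μ} (hf : 0 ≤ f) (hg : 0 ≤ g) :
    0 ≤ inner ℝ f g := by
  rw [L2.inner_def]
  refine integral_nonneg_of_ae ?_
  filter_upwards [(Lp.coeFn_nonneg f).2 hf, (Lp.coeFn_nonneg g).2 hg] with x hx hy
  exact mul_nonneg hy hx

/-- The quadratic data of a symmetric Markov operator on the level sets of a simple function. -/
lemma exists_kernel (hT : IsSymmetricMarkovSemigroup E T) {t : ℝ} (ht : 0 ≤ t)
    {s : SimpleFunc X ℝ} (hs : MemLp s 2 μ) :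
    ∃ (w : ℝ → ℝ) (m : ℝ → ℝ → ℝ), (∀ y z, 0 ≤ m y z) ∧ (∀ y z, m y z = m z y) ∧
      (∀ y, ∑ z ∈ s.range, m y z ≤ w y) ∧
      ∀ (φ ψ : ℝ → ℝ) (hφ : φ 0 = 0) (hψ : ψ 0 = 0),
        inner ℝ (SimpleFunc.memLp_two_map hs hφ).toLp (SimpleFunc.memLp_two_map hs hψ).toLp =
          ∑ y ∈ s.range, φ y * ψ y * w y ∧
        inner ℝ (T t (SimpleFunc.memLp_two_map hs hφ).toLp)
          (SimpleFunc.memLp_two_map hs hψ).toLp =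
          ∑ y ∈ s.range, ∑ z ∈ s.range, φ y * ψ z * m y z := by
  obtain ⟨e, ez, e0, eo, e1, ed⟩ := SimpleFunc.exists_level_decomposition hs
  refine ⟨fun y => inner ℝ (e y) (e y), fun y z => inner ℝ (T t (e y)) (e z), ?_, ?_, ?_, ?_⟩
  · exact fun y z => inner_nonneg_of_nonneg (hT.positivity t ht _ (e0 y)) (e0 z)
  · intro y z
    exact (hT.inner_apply_comm ht _ _).trans (real_inner_comm _ _)
  · intro y
    -- `θ ∘ s` is the indicator of the support of `s`, a square integrable substitute for the
    -- constant `1`; row sums are controlled by `T t (θ ∘ s) ≤ 1`.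
    obtain ⟨θ, hθ⟩ : ∃ θ : ℝ → ℝ, ∀ r, θ r = if r = 0 then 0 else 1 := ⟨_, fun _ => rfl⟩
    have h0 : θ 0 = 0 := by simp [hθ]
    have h := ed θ h0
    set g := (SimpleFunc.memLp_two_map hs h0).toLp with hg
    have hg1 : ∀ᵐ x ∂μ, |g x| ≤ 1 := by
      filter_upwards [(SimpleFunc.memLp_two_map hs h0).coeFn_toLp] with x hx
      rw [hx, SimpleFunc.map_apply, hθ]
      split_ifs <;> simp
    have h2 : ∑ z ∈ s.range, inner ℝ (T t (e y)) (e z) = inner ℝ (T t (e y)) g := by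
      rw [h, inner_sum]
      refine Finset.sum_congr rfl fun z hz => ?_
      rw [inner_smul_right, hθ]
      split_ifs with hz0
      · simp [hz0, ez]
      · simp
    rw [h2, hT.inner_apply_comm ht]
    refine e1 y _ ?_
    filter_upwards [hT.ae_abs_apply_le ht zero_le_one hg1] with x hx
    exact (le_abs_self _).trans hx
  · intro φ ψ hφ hψ
    rw [ed φ hφ, ed ψ hψ]
    constructor
    · rw [sum_inner]
      refine Finset.sum_congr rfl fun y hy => ?_
      rw [inner_sum, Finset.sum_eq_single y]
      · rw [inner_smul_left, inner_smul_right]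
        simp only [conj_trivial]
        ring
      · intro z _ hz
        rw [inner_smul_left, inner_smul_right, eo y z hz.symm]
        simp
      · exact fun h => absurd hy h
    · rw [map_sum, sum_inner]
      refine Finset.sum_congr rfl fun y hy => ?_
      rw [inner_sum]
      refine Finset.sum_congr rfl fun z hz => ?_
      rw [map_smul, inner_smul_left, inner_smul_right]
      simp only [conj_trivial]
      ring

end IsSymmetricMarkovSemigroup

/-! ### Fatou's lemma. -/

section Fatou

variable {X : Type*} [MeasurableSpace X] {μ : Measure X}

/-- A real-valued form of Fatou's lemma. -/
lemma integrable_of_tendsto_of_integral_le {h : ℕ → X → ℝ} {H : X → ℝ} {c : ℕ → ℝ} {C : ℝ}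
    (hint : ∀ n, Integrable (h n) μ) (hpos : ∀ n, 0 ≤ᵐ[μ] h n)
    (hlim : ∀ᵐ x ∂μ, Tendsto (fun n => h n x) atTop (𝓝 (H x)))
    (hle : ∀ᶠ n in atTop, ∫ x, h n x ∂μ ≤ c n) (hc : Tendsto c atTop (𝓝 C)) :
    Integrable H μ ∧ ∫ x, H x ∂μ ≤ C := by
  have hpos' : ∀ᵐ x ∂μ, ∀ n, 0 ≤ h n x := ae_all_iff.2 hpos
  have hH : 0 ≤ᵐ[μ] H := by
    filter_upwards [hpos', hlim] with x h1 h2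
    exact ge_of_tendsto' h2 h1
  have hm : AEStronglyMeasurable H μ :=
    aestronglyMeasurable_of_tendsto_ae _ (fun n => (hint n).1) hlim
  have hC : 0 ≤ C := ge_of_tendsto hc (by
    filter_upwards [hle] with n hn
    exact (integral_nonneg_of_ae (hpos n)).trans hn)
  have key : ∫⁻ x, ENNReal.ofReal (H x) ∂μ ≤ ENNReal.ofReal C := by
    calc ∫⁻ x, ENNReal.ofReal (H x) ∂μ
        = ∫⁻ x, liminf (fun n => ENNReal.ofReal (h n x)) atTop ∂μ := by
          refine lintegral_congr_ae ?_
          filter_upwards [hlim] with x hx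
          exact ((ENNReal.continuous_ofReal.tendsto _).comp hx).liminf_eq.symm
      _ ≤ liminf (fun n => ∫⁻ x, ENNReal.ofReal (h n x) ∂μ) atTop :=
          lintegral_liminf_le' fun n => (hint n).1.aemeasurable.ennreal_ofReal
      _ ≤ liminf (fun n => ENNReal.ofReal (c n)) atTop := by
          refine liminf_le_liminf ?_
          filter_upwards [hle] with n hn
          rw [← ofReal_integral_eq_lintegral_ofReal (hint n) (hpos n)]
          exact ENNReal.ofReal_le_ofReal hn
      _ = ENNReal.ofReal C := ((ENNReal.continuous_ofReal.tendsto _).comp hc).liminf_eq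
  have hi : Integrable H μ :=
    (lintegral_ofReal_ne_top_iff_integrable hm hH).1 (key.trans_lt ENNReal.ofReal_lt_top).ne
  refine ⟨hi, ?_⟩
  rw [← ofReal_integral_eq_lintegral_ofReal hi hH] at key
  exact (ENNReal.ofReal_le_ofReal_iff hC).1 key

end Fatou

/-! ### Comparison of approximate energies, and interpolation of smoothing bounds. -/

namespace IsSymmetricMarkovSemigroup

variable {X : Type*} [MeasurableSpace X] {μ : Measure X} {E : ClosedForm μ}
  {T : ℝ → Lp ℝ 2 μ →L[ℝ] Lp ℝ 2 μ}

/-- Comparison of approximate energies. -/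
lemma inner_sub_compLp_le (hT : IsSymmetricMarkovSemigroup E T) {t : ℝ} (ht : 0 ≤ t)
    {φ ψ : ℝ → ℝ} {c d : NNReal} (hφ : LipschitzWith c φ) (hψ : LipschitzWith d ψ)
    (hφ0 : φ 0 = 0) (hψ0 : ψ 0 = 0) (h : ∀ a b, (φ a - φ b) ^ 2 ≤ (a - b) * (ψ a - ψ b))
    (u : Lp ℝ 2 μ) :
    inner ℝ (hφ.compLp hφ0 u) (hφ.compLp hφ0 u) -
        inner ℝ (T t (hφ.compLp hφ0 u)) (hφ.compLp hφ0 u) ≤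
      inner ℝ u (hψ.compLp hψ0 u) - inner ℝ (T t u) (hψ.compLp hψ0 u) := by
  have c1 := hφ.continuous_compLp hφ0 (p := 2) (μ := μ)
  have c2 := hψ.continuous_compLp hψ0 (p := 2) (μ := μ)
  -- Both sides are continuous in `u`, so it suffices to treat simple functions, where the matrix
  -- inequality applies.
  refine (Lp.simpleFunc.denseRange (E := ℝ) (μ := μ) (p := 2)
    ENNReal.ofNat_ne_top).induction_on u (isClosed_le ?_ ?_) ?_
  · exact (c1.inner c1).sub (((T t).continuous.comp c1).inner c1)
  · exact (continuous_id.inner c2).sub ((T t).continuous.inner c2)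
  · intro f
    have hs := Lp.simpleFunc.memLp f
    set s := Lp.simpleFunc.toSimpleFunc f with hsdef
    have hsf : (s : X → ℝ) =ᵐ[μ] (f : Lp ℝ 2 μ) := Lp.simpleFunc.toSimpleFunc_eq_toFun f
    have e1 : hφ.compLp hφ0 (f : Lp ℝ 2 μ) = (SimpleFunc.memLp_two_map hs hφ0).toLp := by
      refine Lp.ext ?_
      filter_upwards [hφ.coeFn_compLp hφ0 (f : Lp ℝ 2 μ), hsf,
        (SimpleFunc.memLp_two_map hs hφ0).coeFn_toLp] with x h1 h2 h3
      rw [h1, h3, SimpleFunc.map_apply, h2, Function.comp]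
    have e2 : hψ.compLp hψ0 (f : Lp ℝ 2 μ) = (SimpleFunc.memLp_two_map hs hψ0).toLp := by
      refine Lp.ext ?_
      filter_upwards [hψ.coeFn_compLp hψ0 (f : Lp ℝ 2 μ), hsf,
        (SimpleFunc.memLp_two_map hs hψ0).coeFn_toLp] with x h1 h2 h3
      rw [h1, h3, SimpleFunc.map_apply, h2, Function.comp]
    have e3 : (f : Lp ℝ 2 μ) = (SimpleFunc.memLp_two_map hs (φ := fun y => y) rfl).toLp := by
      refine Lp.ext ?_
      filter_upwards [hsf, (SimpleFunc.memLp_two_map hs (φ := fun y => y) rfl).coeFn_toLp]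
        with x h2 h3
      rw [h3, SimpleFunc.map_apply, h2]
    rw [e1, e2]
    nth_rw 1 2 [e3]
    obtain ⟨w, m, m0, ms, mw, hk⟩ := hT.exists_kernel ht hs
    rw [(hk _ _ hφ0 hφ0).1, (hk _ _ hφ0 hφ0).2, (hk _ _ rfl hψ0).1, (hk _ _ rfl hψ0).2]
    exact sum_energy_le m0 ms mw hφ0 hψ0 h

/-- The bound `‖T s g‖₂² ≤ K ‖g‖_r²`, `1 / r = (1 + θ) / 2`, for nonnegative simple functions. -/
def SmoothingBound (μ : Measure X) (T : ℝ → Lp ℝ 2 μ →L[ℝ] Lp ℝ 2 μ) (s K θ : ℝ) : Prop :=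
  ∀ (g : SimpleFunc X ℝ) (hg : MemLp g 2 μ), (∀ x, 0 ≤ g x) →
    ‖T s hg.toLp‖ ^ 2 ≤ K * (∫ x, g x ^ (2 / (1 + θ)) ∂μ) ^ (1 + θ)

/-- Interpolation with the trivial bound on `L²`. -/
lemma SmoothingBound.half (hT : IsSymmetricMarkovSemigroup E T) {s K θ : ℝ} (hs : 0 ≤ s)
    (hθ : 0 < θ) (h : SmoothingBound μ T s K θ) :
    SmoothingBound μ T (s / 2) (√K) (θ / 2) := by
  intro g hg hg0
  have hα : (0 : ℝ) < 1 / (1 + θ / 2) := by positivity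
  have hγ : 0 < (1 + θ) / (1 + θ / 2) := by positivity
  -- The exponents add up to 2, and `u(g)²` and `v(g)^{2/(1+θ)}` are both `g^{2/(1+θ/2)}`: the two
  -- norms involve the same integral `I`.
  obtain ⟨u, hu⟩ : ∃ u : ℝ → ℝ, ∀ y, u y = y ^ (1 / (1 + θ / 2)) := ⟨_, fun _ => rfl⟩
  obtain ⟨v, hv⟩ : ∃ v : ℝ → ℝ, ∀ y, v y = y ^ ((1 + θ) / (1 + θ / 2)) := ⟨_, fun _ => rfl⟩
  have hu0 : u 0 = 0 := by rw [hu, Real.zero_rpow hα.ne']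
  have hv0 : v 0 = 0 := by rw [hv, Real.zero_rpow hγ.ne']
  obtain ⟨w, m, m0, ms, mw, hk⟩ := hT.exists_kernel hs hg
  have e3 : hg.toLp = (SimpleFunc.memLp_two_map hg (φ := fun y => y) rfl).toLp := by
    refine Lp.ext ?_
    filter_upwards [hg.coeFn_toLp, (SimpleFunc.memLp_two_map hg (φ := fun y => y) rfl).coeFn_toLp]
      with x h2 h3
    rw [h3, SimpleFunc.map_apply, h2]
  have hrange : ∀ y ∈ g.range, 0 ≤ y := by
    intro y hy
    obtain ⟨x, rfl⟩ := SimpleFunc.mem_range.1 hy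
    exact hg0 x
  set U := (SimpleFunc.memLp_two_map hg hu0).toLp with hU
  set V := (SimpleFunc.memLp_two_map hg hv0).toLp with hV
  have h1 : ‖T (s / 2) hg.toLp‖ ^ 2 ≤ ‖U‖ * ‖T s V‖ := by
    have hs2 : 0 ≤ s / 2 := by positivity
    rw [← real_inner_self_eq_norm_sq, ← hT.inner_apply_add hs2 hs2, add_halves]
    refine le_trans ?_ (real_inner_le_norm U (T s V))
    rw [← hT.inner_apply_comm hs, hU, hV, (hk _ _ hu0 hv0).2, e3, (hk _ _ rfl rfl).2]
    refine sum_mul_le_of_sq_eq m0 ms (fun y hy => ?_) (fun y hy => ?_) (fun y hy => ?_)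
    · rw [hu]; exact Real.rpow_nonneg (hrange y hy) _
    · rw [hv]; exact Real.rpow_nonneg (hrange y hy) _
    · rw [hu, hv]
      rcases (hrange y hy).eq_or_lt with rfl | hy
      · rw [Real.zero_rpow hα.ne']; simp
      · rw [← Real.rpow_add hy, ← add_div, show (1 + (1 + θ)) / (1 + θ / 2) = 2 by
          field_simp; ring, Real.rpow_two]
  set I := ∫ x, g x ^ (2 / (1 + θ / 2)) ∂μ with hI
  have hI0 : 0 ≤ I := integral_nonneg fun x => Real.rpow_nonneg (hg0 x) _
  have h2 : ‖U‖ ^ 2 = I := by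
    rw [← real_inner_self_eq_norm_sq, L2.inner_def]
    refine integral_congr_ae ?_
    filter_upwards [(SimpleFunc.memLp_two_map hg hu0).coeFn_toLp] with x hx
    rw [hx, SimpleFunc.map_apply, hu, real_inner_self_eq_norm_sq, Real.norm_eq_abs, sq_abs,
      ← Real.rpow_natCast, ← Real.rpow_mul (hg0 x)]
    congr 1
    push_cast
    ring
  have h3 : ‖T s V‖ ^ 2 ≤ K * I ^ (1 + θ) := by
    have := h (g.map v) (SimpleFunc.memLp_two_map hg hv0) (fun x => by
      rw [SimpleFunc.map_apply, hv]; exact Real.rpow_nonneg (hg0 x) _)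
    convert this using 4
    ext x
    rw [SimpleFunc.map_apply, hv, ← Real.rpow_mul (hg0 x)]
    congr 1
    field_simp
  have h4 : (‖U‖ * ‖T s V‖) ^ 2 ≤ K * (I ^ (1 + θ / 2)) ^ 2 := by
    rw [mul_pow, h2]
    refine (mul_le_mul_of_nonneg_left h3 hI0).trans (le_of_eq ?_)
    rw [← Real.rpow_natCast (I ^ _), ← Real.rpow_mul hI0, mul_left_comm]
    congr 1
    rw [show (1 + θ / 2) * ((2 : ℕ) : ℝ) = 1 + (1 + θ) by push_cast; ring,
      Real.rpow_add' hI0 (y := 1) (z := 1 + θ) (by positivity), Real.rpow_one]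
  refine h1.trans (((le_abs_self _).trans (Real.abs_le_sqrt h4)).trans (le_of_eq ?_))
  rw [Real.sqrt_mul' _ (by positivity), Real.sqrt_sq (Real.rpow_nonneg hI0 _)]

lemma SmoothingBound.dyadic (hT : IsSymmetricMarkovSemigroup E T) {t K κ : ℝ} (ht : 0 ≤ t)
    (hK : 0 ≤ K) (hκ : 0 < κ) (h : SmoothingBound μ T t K κ) (n : ℕ) :
    SmoothingBound μ T (t * (1 / 2) ^ n) (K ^ ((1 / 2 : ℝ) ^ n)) (κ * (1 / 2) ^ n) := by
  induction n with
  | zero => simpa using h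
  | succ n ih =>
    have := ih.half hT (by positivity) (by positivity)
    rw [Real.sqrt_eq_rpow, ← Real.rpow_mul hK] at this
    convert this using 1 <;> ring_nf

/-- The smoothing bound for general functions. -/
lemma SmoothingBound.norm_sq_le (hT : IsSymmetricMarkovSemigroup E T) {s K θ : ℝ} (hs : 0 ≤ s)
    (hθ : 0 < θ) (h : SmoothingBound μ T s K θ) (f : Lp ℝ 2 μ)
    (hf : Integrable (fun x => |f x| ^ (2 / (1 + θ))) μ) :
    ‖T s f‖ ^ 2 ≤ K * (∫ x, |f x| ^ (2 / (1 + θ)) ∂μ) ^ (1 + θ) := by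
  have hr : 0 < 2 / (1 + θ) := by positivity
  have h1 : ‖T s f‖ ≤ ‖T s |f|‖ := norm_le_norm_of_abs_le_abs
    ((hT.abs_apply_le hs f).trans (le_abs_self _))
  refine (pow_le_pow_left₀ (norm_nonneg _) h1 2).trans ?_
  obtain ⟨g, hg, g0, gle, glim, gL⟩ := exists_simpleFunc_nonneg_tendsto |f| (abs_nonneg f)
  have l1 : Tendsto (fun n => ‖T s (hg n).toLp‖ ^ 2) atTop (𝓝 (‖T s |f|‖ ^ 2)) :=
    (((T s).continuous.tendsto _).comp gL).norm.pow 2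
  have l2 : Tendsto (fun n => ∫ x, g n x ^ (2 / (1 + θ)) ∂μ) atTop
      (𝓝 (∫ x, |f x| ^ (2 / (1 + θ)) ∂μ)) := by
    refine tendsto_integral_of_dominated_convergence
      (fun x => 2 ^ (2 / (1 + θ)) * |f x| ^ (2 / (1 + θ))) (fun n => ?_)
      (hf.const_mul _) (fun n => ?_) ?_
    · exact ((g n).measurable.pow_const _).aestronglyMeasurable
    · filter_upwards [gle n, Lp.coeFn_abs f] with x hx hx'
      rw [hx'] at hx
      rw [Real.norm_of_nonneg (Real.rpow_nonneg (g0 n x) _), ← Real.mul_rpow two_pos.le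
        (abs_nonneg _)]
      exact Real.rpow_le_rpow (g0 n x) hx hr.le
    · filter_upwards [glim, Lp.coeFn_abs f] with x hx hx'
      rw [hx'] at hx
      exact hx.rpow_const (Or.inr hr.le)
  exact le_of_tendsto_of_tendsto' l1 ((l2.rpow_const (Or.inr (by positivity))).const_mul K)
    fun n => h (g n) (hg n) (g0 n)

end IsSymmetricMarkovSemigroup

/-! ### Differentiating `∫ |f|^r` at `r = 2`. -/

section LogSobolevOfSmoothing

variable {X : Type*} [MeasurableSpace X] {μ : Measure X}

lemma entropy_sq (f : X → ℝ) :
    entropy μ (fun x => f x ^ 2) = (∫ x, f x ^ 2 * Real.log (f x ^ 2) ∂μ) -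
      (∫ x, f x ^ 2 ∂μ) * Real.log (∫ x, f x ^ 2 ∂μ) := by
  simp [entropy]

lemma integral_sq_eq_norm_sq (f : Lp ℝ 2 μ) : ∫ x, f x ^ 2 ∂μ = ‖f‖ ^ 2 := by
  rw [← real_inner_self_eq_norm_sq, L2.inner_def]
  simp [sq]

/-- Weighted arithmetic–geometric mean for `x^{2-r} (x²)^{r-1}`. It dominates `|f|^r` for `f ∈ L¹ ∩
L²` and bounds the difference quotients at `r = 2` from below by `x² - x`. -/
lemma rpow_le_add_sq {x r : ℝ} (hx : 0 ≤ x) (h1 : 1 ≤ r) (h2 : r ≤ 2) :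
    x ^ r ≤ (2 - r) * x + (r - 1) * x ^ 2 := by
  have := Real.geom_mean_le_arith_mean2_weighted (sub_nonneg.2 h2) (sub_nonneg.2 h1) hx
    (sq_nonneg x) (by ring)
  refine le_trans (le_of_eq ?_) this
  rw [← Real.rpow_natCast x, ← Real.rpow_mul hx, ← Real.rpow_add' hx]
  · congr 1; push_cast; ring
  · push_cast; linarith

lemma MeasureTheory.Integrable.abs_rpow {f : X → ℝ} (hf1 : Integrable f μ)
    (hf2 : Integrable (fun x => f x ^ 2) μ) {r : ℝ} (h1 : 1 ≤ r) (h2 : r ≤ 2) :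
    Integrable (fun x => |f x| ^ r) μ := by
  refine (hf1.abs.add hf2).mono' ((hf1.1.norm.aemeasurable.pow_const _).aestronglyMeasurable)
    (Eventually.of_forall fun x => ?_)
  rw [Real.norm_of_nonneg (Real.rpow_nonneg (abs_nonneg _) _)]
  have h := rpow_le_add_sq (abs_nonneg (f x)) h1 h2
  rw [sq_abs] at h
  refine h.trans ?_
  simp only [Pi.add_apply]
  nlinarith [abs_nonneg (f x), sq_nonneg (f x)]

lemma tendsto_slope_rpow_two {x : ℝ} (hx : 0 ≤ x) {r : ℕ → ℝ} (hr : ∀ n, r n < 2)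
    (hr1 : ∀ n, 1 ≤ r n)
    (hlim : Tendsto r atTop (𝓝 2)) :
    Tendsto (fun n => (x ^ 2 - x ^ r n) / (2 - r n)) atTop (𝓝 (x ^ 2 * Real.log x)) := by
  rcases hx.eq_or_lt with rfl | hx
  · have : ∀ n, r n ≠ 0 := fun n => by linarith [hr1 n]
    simp [Real.zero_rpow (this _)]
  · have hd := (Real.hasStrictDerivAt_const_rpow hx 2).hasDerivAt.tendsto_slope
    have h2 : Tendsto r atTop (𝓝[≠] 2) :=
      tendsto_nhdsWithin_iff.2 ⟨hlim, Eventually.of_forall fun n => (hr n).ne⟩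
    rw [Real.rpow_two] at hd
    refine (hd.comp h2).congr fun n => ?_
    simp only [Function.comp, slope_def_field, Real.rpow_two]
    rw [← neg_div_neg_eq, neg_sub, neg_sub]

/-- A bound on the growth of `∫ |f|^r` as `r → 2` controls `∫ f² log |f|`. -/
lemma integrable_sq_mul_log {f : X → ℝ} (hf1 : Integrable f μ)
    (hf2 : Integrable (fun x => f x ^ 2) μ) {r : ℕ → ℝ} (hr : ∀ n, r n < 2) (hr1 : ∀ n, 1 ≤ r n)
    (hlim : Tendsto r atTop (𝓝 2)) {c : ℕ → ℝ} {C : ℝ}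
    (hle : ∀ᶠ n in atTop,
      ((∫ x, f x ^ 2 ∂μ) - ∫ x, |f x| ^ r n ∂μ) / (2 - r n) ≤ c n)
    (hc : Tendsto c atTop (𝓝 C)) :
    Integrable (fun x => f x ^ 2 * Real.log |f x|) μ ∧ ∫ x, f x ^ 2 * Real.log |f x| ∂μ ≤ C := by
  have hint : ∀ n, Integrable (fun x => |f x| ^ r n) μ :=
    fun n => hf1.abs_rpow hf2 (hr1 n) (hr n).le
  have hd : Integrable (fun x => f x ^ 2 - |f x|) μ := hf2.sub hf1.abs
  have hn : ∀ n, Integrable (fun x => (f x ^ 2 - |f x| ^ r n) / (2 - r n)) μ :=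
    fun n => (hf2.sub (hint n)).div_const _
  -- Subtracting the integrable lower bound `f² - |f|` makes the quotients nonnegative, as Fatou
  -- requires.
  have key := integrable_of_tendsto_of_integral_le
    (h := fun n x => (f x ^ 2 - |f x| ^ r n) / (2 - r n) - (f x ^ 2 - |f x|))
    (H := fun x => f x ^ 2 * Real.log |f x| - (f x ^ 2 - |f x|))
    (c := fun n => c n - ∫ x, (f x ^ 2 - |f x|) ∂μ) (C := C - ∫ x, (f x ^ 2 - |f x|) ∂μ)
    (fun n => (hn n).sub hd) (fun n => Eventually.of_forall fun x => ?_)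
    (Eventually.of_forall fun x => ?_) ?_ (hc.sub_const _)
  · have h1 := key.1.add hd
    simp only [Pi.add_def, sub_add_cancel] at h1
    refine ⟨h1, ?_⟩
    have h2 := key.2
    rw [integral_sub h1 hd] at h2
    linarith
  · have h := rpow_le_add_sq (abs_nonneg (f x)) (hr1 n) (hr n).le
    rw [sq_abs] at h
    simp only [Pi.zero_apply]
    rw [sub_nonneg, le_div_iff₀ (by linarith [hr n])]
    nlinarith
  · have h := tendsto_slope_rpow_two (abs_nonneg (f x)) hr hr1 hlim
    simp only [sq_abs] at h
    exact h.sub_const _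
  · filter_upwards [hle] with n hn'
    rw [integral_sub (hn n) hd, integral_div, integral_sub hf2 (hint n)]
    linarith

end LogSobolevOfSmoothing

/-! ### From contractivity to logarithmic Sobolev inequalities. -/

namespace IsSymmetricMarkovSemigroup

variable {X : Type*} [MeasurableSpace X] {μ : Measure X} {E : ClosedForm μ}
  {T : ℝ → Lp ℝ 2 μ →L[ℝ] Lp ℝ 2 μ}

/-- The numerator vanishes at `δ = 0` and has derivative `e + A b + κ A log A` there, while the
denominator is `2κδ/(1+κδ)`. -/
lemma tendsto_smoothing_slope {A e b κ : ℝ} (hA : 0 < A) (hκ : 0 < κ) {δ : ℕ → ℝ}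
    (hδ : ∀ n, 0 < δ n) (hlim : Tendsto δ atTop (𝓝 0)) :
    Tendsto (fun n => (A - Real.exp ((Real.log (A - e * δ n) - b * δ n) / (1 + κ * δ n))) /
      (2 - 2 / (1 + κ * δ n))) atTop
      (𝓝 ((e + A * b + κ * A * Real.log A) / (2 * κ))) := by
  have d0 : HasDerivAt (fun δ : ℝ => 1 + κ * δ) κ 0 := by
    simpa using ((hasDerivAt_id (0 : ℝ)).const_mul κ).const_add 1
  have d1 : HasDerivAt (fun δ : ℝ => A - e * δ) (-e) 0 := by
    simpa using ((hasDerivAt_id (0 : ℝ)).const_mul e).const_sub A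
  have d2 : HasDerivAt (fun δ : ℝ => b * δ) b 0 := by
    simpa using (hasDerivAt_id (0 : ℝ)).const_mul b
  have d3 := (((d1.log (by simpa using hA.ne')).sub d2).div d0 (by simp)).exp
  have h2 : Tendsto δ atTop (𝓝[≠] 0) :=
    tendsto_nhdsWithin_iff.2 ⟨hlim, Eventually.of_forall fun n => (hδ n).ne'⟩
  have h3 := d3.tendsto_slope_zero.comp h2
  have h4 : Tendsto (fun n => -(1 + κ * δ n) / (2 * κ)) atTop (𝓝 (-1 / (2 * κ))) := by
    have := ((hlim.const_mul κ).const_add 1).neg.div_const (2 * κ)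
    simpa using this
  have h5 := h3.mul h4
  simp only [Pi.sub_apply, Pi.div_apply, mul_zero, sub_zero, add_zero, div_one, mul_one,
    Real.exp_log hA] at h5
  convert h5 using 1
  · ext n
    have := hδ n
    have h6 : 0 < 1 + κ * δ n := by positivity
    simp only [Function.comp, smul_eq_mul, zero_add]
    rw [show 2 - 2 / (1 + κ * δ n) = 2 * κ * δ n / (1 + κ * δ n) by field_simp; ring]
    field_simp
    ring
  · congr 1
    field_simp
    ring

/-- The smoothing bounds at times `tδ`, `δ = 2^{-n}`, are equalities in the limit `δ = 0`, and the
first-order terms give the claim. The condition `κ ≤ 1` keeps the exponents `2/(1+κδ)` in `[1, 2]`,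
where `L¹ ∩ L²` gives integrability. -/
lemma logSobolev_of_smoothingBound (hT : IsSymmetricMarkovSemigroup E T) {t B κ : ℝ}
    (ht : 0 < t) (hB : 0 ≤ B) (hκ : 0 < κ) (hκ1 : κ ≤ 1)
    (h : SmoothingBound μ T t (B ^ 2) κ) (f : E.domain) (hf : MemLp (f : Lp ℝ 2 μ) 1 μ) :
    Integrable (fun x => (f : Lp ℝ 2 μ) x ^ 2 * Real.log ((f : Lp ℝ 2 μ) x ^ 2)) μ ∧
    entropy μ (fun x => (f : Lp ℝ 2 μ) x ^ 2) ≤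
      2 * (κ⁻¹ * Real.log B) * ‖(f : Lp ℝ 2 μ)‖ ^ 2 + 2 * (t / κ) * E.energy f := by
  have hE : 0 ≤ E.energy f := E.nonneg f
  set A := ‖(f : Lp ℝ 2 μ)‖ ^ 2 with hAdef
  rcases (show 0 ≤ A by positivity).eq_or_lt with hA | hA
  · have h0 : (f : Lp ℝ 2 μ) = 0 := by
      rw [hAdef, eq_comm, sq_eq_zero_iff, norm_eq_zero] at hA
      exact hA
    have h1 : ∀ᵐ x ∂μ, (f : Lp ℝ 2 μ) x = 0 := by
      rw [h0]
      exact Lp.coeFn_zero ℝ 2 μ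
    have h2 : (fun x => (f : Lp ℝ 2 μ) x ^ 2 * Real.log ((f : Lp ℝ 2 μ) x ^ 2)) =ᵐ[μ]
        fun _ => (0 : ℝ) := by
      filter_upwards [h1] with x hx
      simp [hx]
    refine ⟨(integrable_congr h2).2 (integrable_zero _ _ _), ?_⟩
    rw [entropy_sq, integral_congr_ae h2, integral_sq_eq_norm_sq, ← hAdef, ← hA]
    simp
    positivity
  have hf1 : Integrable (f : Lp ℝ 2 μ) μ := memLp_one_iff_integrable.1 hf
  have hf2 : Integrable (fun x => (f : Lp ℝ 2 μ) x ^ 2) μ := (Lp.memLp _).integrable_sq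
  set δ : ℕ → ℝ := fun n => (1 / 2) ^ n with hδdef
  have hδ : ∀ n, 0 < δ n := fun n => by positivity
  have hδ1 : ∀ n, δ n ≤ 1 := fun n => pow_le_one₀ (by norm_num) (by norm_num)
  have hδlim : Tendsto δ atTop (𝓝 0) :=
    tendsto_pow_atTop_nhds_zero_of_lt_one (by norm_num) (by norm_num)
  have hκδ : ∀ n, 0 < κ * δ n := fun n => mul_pos hκ (hδ n)
  have hκδ1 : ∀ n, κ * δ n ≤ 1 := fun n => mul_le_one₀ hκ1 (hδ n).le (hδ1 n)
  have hr : ∀ n, 2 / (1 + κ * δ n) < 2 := fun n => by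
    rw [div_lt_iff₀ (by linarith [hκδ n])]
    linarith [hκδ n]
  have hr1 : ∀ n, 1 ≤ 2 / (1 + κ * δ n) := fun n => by
    rw [le_div_iff₀ (by linarith [hκδ n])]
    linarith [hκδ1 n]
  have hrlim : Tendsto (fun n => 2 / (1 + κ * δ n)) atTop (𝓝 2) := by
    have h1 : Tendsto (fun n => 1 + κ * δ n) atTop (𝓝 1) := by
      simpa using (hδlim.const_mul κ).const_add 1
    have h2 := (tendsto_const_nhds (x := (2 : ℝ))).div h1 one_ne_zero
    rw [div_one] at h2
    exact h2
  have hint : ∀ n, Integrable (fun x => |(f : Lp ℝ 2 μ) x| ^ (2 / (1 + κ * δ n))) μ :=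
    fun n => hf1.abs_rpow hf2 (hr1 n) (hr n).le
  have key : ∀ n, A - 2 * t * E.energy f * δ n ≤ (B ^ 2) ^ δ n *
      (∫ x, |(f : Lp ℝ 2 μ) x| ^ (2 / (1 + κ * δ n)) ∂μ) ^ (1 + κ * δ n) := by
    intro n
    have htδ : 0 ≤ t * δ n := by have := hδ n; positivity
    have h1 := (h.dyadic hT ht.le (sq_nonneg B) hκ n).norm_sq_le hT htδ
      (hκδ n) f (hint n)
    have h2 := hT.norm_sq_sub_le_inner (add_nonneg htδ htδ) f
    rw [hT.inner_apply_add htδ htδ, real_inner_self_eq_norm_sq] at h2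
    refine le_trans ?_ (h2.trans h1)
    linarith
  -- If `B = 0`, the bound says `A ≤ 2tδ 𝓔(f)` for all `δ = 2^{-n}`, contradicting `A > 0`.
  have hB0 : 0 < B := by
    refine hB.lt_of_ne' fun hB0 => hA.not_ge ?_
    have hl : Tendsto (fun n => 2 * t * E.energy f * δ n) atTop (𝓝 0) := by
      simpa using hδlim.const_mul (2 * t * E.energy f)
    refine ge_of_tendsto' hl fun n => ?_
    have := key n
    rw [hB0, zero_pow two_ne_zero, Real.zero_rpow (hδ n).ne', zero_mul] at this
    linarith
  obtain ⟨hi, hle⟩ := integrable_sq_mul_log hf1 hf2 hr hr1 hrlim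
    (c := fun n => (A - Real.exp ((Real.log (A - 2 * t * E.energy f * δ n) -
      2 * Real.log B * δ n) / (1 + κ * δ n))) / (2 - 2 / (1 + κ * δ n))) (by
      have hpos : ∀ᶠ n in atTop, 0 < A - 2 * t * E.energy f * δ n := by
        have : Tendsto (fun n => A - 2 * t * E.energy f * δ n) atTop (𝓝 A) := by
          simpa using (hδlim.const_mul (2 * t * E.energy f)).const_sub A
        exact this.eventually (lt_mem_nhds hA)
      filter_upwards [hpos] with n hn
      have h6 : 0 < 1 + κ * δ n := by linarith [hκδ n]
      refine div_le_div_of_nonneg_right ?_ (by linarith [hr n])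
      rw [integral_sq_eq_norm_sq, ← hAdef]
      refine sub_le_sub_left ?_ _
      set a := ∫ x, |(f : Lp ℝ 2 μ) x| ^ (2 / (1 + κ * δ n)) ∂μ with ha
      have ha0 : 0 ≤ a := integral_nonneg fun x => Real.rpow_nonneg (abs_nonneg _) _
      have hk := key n
      have hB2 : (0 : ℝ) < (B ^ 2) ^ δ n := by positivity
      have ha1 : 0 < a := by
        refine ha0.lt_of_ne fun h => ?_
        rw [← ha, ← h, Real.zero_rpow h6.ne', mul_zero] at hk
        linarith
      have hl := Real.log_le_log hn hk
      rw [Real.log_mul hB2.ne' (by positivity), Real.log_rpow (by positivity),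
        Real.log_rpow ha1, Real.log_pow] at hl
      rw [← Real.le_log_iff_exp_le ha1, div_le_iff₀ h6]
      push_cast at hl
      linarith)
    (tendsto_smoothing_slope hA hκ hδ hδlim)
  have hlog : ∀ x, (f : Lp ℝ 2 μ) x ^ 2 * Real.log ((f : Lp ℝ 2 μ) x ^ 2) =
      2 * ((f : Lp ℝ 2 μ) x ^ 2 * Real.log |(f : Lp ℝ 2 μ) x|) := by
    intro x
    rw [Real.log_pow, Real.log_abs]
    push_cast
    ring
  simp only [entropy_sq, hlog, integral_const_mul, integral_sq_eq_norm_sq, ← hAdef]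
  refine ⟨hi.const_mul 2, ?_⟩
  have : (2 * t * E.energy f + A * (2 * Real.log B) + κ * A * Real.log A) / (2 * κ) =
      (κ⁻¹ * Real.log B) * A + t / κ * E.energy f + A * Real.log A / 2 := by
    field_simp
    ring
  rw [this] at hle
  linarith

lemma sq_le_of_sq_le_mul {a b c : ℝ} (ha : 0 ≤ a) (hb : 0 ≤ b) (hc : 0 ≤ c)
    (h : a ^ 2 ≤ b * a * c) : a ^ 2 ≤ b ^ 2 * c ^ 2 := by
  rw [← mul_pow]
  refine pow_le_pow_left₀ ha ?_ 2
  rcases ha.eq_or_lt with rfl | ha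
  · positivity
  · exact le_of_mul_le_mul_right (by nlinarith) ha

/-- Duality: `‖T t g‖² = ⟨T t (T t g), g⟩ ≤ B ‖T t g‖ ‖g‖_{q'}` by Hölder; cancel one factor. With
`θ = 1 - 2/q` the conjugate exponent is `2/(1+θ)`. -/
lemma smoothingBound_of_super (hT : IsSymmetricMarkovSemigroup E T) {B : ℝ → ℝ → ℝ}
    (hB : SupercontractiveWith T B) {q t : ℝ} (hq : 2 < q) (ht : 0 < t) :
    SmoothingBound μ T t (B t q ^ 2) (1 - 2 / q) := by
  intro g hg hg0
  have hB0 := (hB q hq.le t ht).1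
  have hq0 : 0 < q := by linarith
  set F := T t (T t hg.toLp) with hF
  have hconj : q.HolderConjugate (2 / (1 + (1 - 2 / q))) := by
    rw [Real.holderConjugate_iff]
    refine ⟨by linarith, ?_⟩
    field_simp
    ring
  set q' := 2 / (1 + (1 - 2 / q)) with hq'
  have hq'0 : 0 < q' := hconj.symm.pos
  have hI : 1 + (1 - 2 / q) = 2 * (1 / q') := by rw [hq']; field_simp
  rw [hI]
  have hFb := (hB q hq.le t ht).2 (T t hg.toLp)
  have hFq : MemLp F (ENNReal.ofReal q) μ := ⟨Lp.aestronglyMeasurable F, hFb.trans_lt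
    (ENNReal.mul_lt_top ENNReal.ofReal_lt_top (Lp.memLp _).2)⟩
  have hFn : (∫ x, |F x| ^ q ∂μ) ^ (1 / q) ≤ B t q * ‖T t hg.toLp‖ := by
    have h1 := hFq.eLpNorm_eq_integral_rpow_norm (by simpa using hq0) ENNReal.ofReal_ne_top
    rw [ENNReal.toReal_ofReal hq0.le] at h1
    rw [← hF, h1, ← Lp.enorm_def, ← ofReal_norm, ← ENNReal.ofReal_mul hB0,
      ENNReal.ofReal_le_ofReal_iff (by positivity)] at hFb
    rw [one_div]
    exact hFb
  have hgint : MemLp g (ENNReal.ofReal q') μ := by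
    rw [SimpleFunc.memLp_iff_finMeasSupp (by simpa using hq'0) ENNReal.ofReal_ne_top]
    exact (SimpleFunc.memLp_iff_finMeasSupp two_ne_zero ENNReal.ofNat_ne_top).1 hg
  have h1 : ‖T t hg.toLp‖ ^ 2 ≤ ∫ x, |F x| * g x ∂μ := by
    rw [← real_inner_self_eq_norm_sq, ← hT.inner_apply_comm ht.le, ← hF, L2.inner_def]
    refine integral_mono_ae (L2.integrable_inner _ _) ?_ ?_
    · refine (L2.integrable_inner (𝕜 := ℝ) hg.toLp |F|).congr ?_
      filter_upwards [hg.coeFn_toLp, Lp.coeFn_abs F] with x h1 h2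
      rw [h1, h2]
      rfl
    · filter_upwards [hg.coeFn_toLp] with x h1
      rw [h1]
      change g x * F x ≤ _
      rw [mul_comm]
      exact mul_le_mul_of_nonneg_right (le_abs_self _) (hg0 x)
  have h2 := integral_mul_le_Lp_mul_Lq_of_nonneg hconj
    (Eventually.of_forall fun x => abs_nonneg (F x)) (Eventually.of_forall hg0)
    (by simpa using hFq.norm) hgint
  set J := (∫ x, g x ^ q' ∂μ) ^ (1 / q') with hJ
  have hint0 : 0 ≤ ∫ x, g x ^ q' ∂μ := integral_nonneg fun x => Real.rpow_nonneg (hg0 x) _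
  have hJ0 : 0 ≤ J := Real.rpow_nonneg hint0 _
  have h3 : ‖T t hg.toLp‖ ^ 2 ≤ B t q * ‖T t hg.toLp‖ * J :=
    h1.trans (h2.trans (mul_le_mul_of_nonneg_right hFn hJ0))
  rw [mul_comm 2, Real.rpow_mul hint0, ← hJ, Real.rpow_two]
  exact sq_le_of_sq_le_mul (norm_nonneg _) hB0 hJ0 h3

/-- The same duality between `L^∞` and `L¹`, which is the case `θ = 1`. -/
lemma smoothingBound_of_ultra (hT : IsSymmetricMarkovSemigroup E T) {B : ℝ → ℝ}
    (hB : UltracontractiveWith T B) {t : ℝ} (ht : 0 < t) :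
    SmoothingBound μ T t (B t ^ 2) 1 := by
  intro g hg hg0
  have hB0 := (hB t ht).1
  set F := T t (T t hg.toLp) with hF
  have hFb := (hB t ht).2 (T t hg.toLp)
  rw [← hF, ← Lp.enorm_def, ← ofReal_norm, ← ENNReal.ofReal_mul hB0, eLpNorm_exponent_top] at hFb
  have hgint : Integrable g μ :=
    SimpleFunc.integrable_iff_finMeasSupp.2
      ((SimpleFunc.memLp_iff_finMeasSupp two_ne_zero ENNReal.ofNat_ne_top).1 hg)
  have h1 : ‖T t hg.toLp‖ ^ 2 ≤ ∫ x, B t * ‖T t hg.toLp‖ * g x ∂μ := by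
    rw [← real_inner_self_eq_norm_sq, ← hT.inner_apply_comm ht.le, ← hF, L2.inner_def]
    refine integral_mono_ae (L2.integrable_inner _ _) (hgint.const_mul _) ?_
    filter_upwards [hg.coeFn_toLp, ae_le_eLpNormEssSup (f := F) (μ := μ)] with x h1 h2
    have h3 := h2.trans hFb
    rw [← ofReal_norm, ENNReal.ofReal_le_ofReal_iff (by positivity)] at h3
    rw [h1]
    change g x * F x ≤ _
    rw [mul_comm]
    exact mul_le_mul_of_nonneg_right ((le_abs_self _).trans h3) (hg0 x)
  rw [integral_const_mul] at h1
  have hJ0 : 0 ≤ ∫ x, g x ∂μ := integral_nonneg hg0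
  norm_num
  exact sq_le_of_sq_le_mul (norm_nonneg _) hB0 hJ0 h1

lemma logSobolev_of_supercontractive (hT : IsSymmetricMarkovSemigroup E T) {B : ℝ → ℝ → ℝ}
    (hB : SupercontractiveWith T B) {q : ℝ} (hq : 2 < q) :
    LogSobolev E (fun ε => (1 - 2 / q)⁻¹ * Real.log (B (ε * (1 - 2 / q)) q)) := by
  intro ε hε f hf
  have hκ : 0 < 1 - 2 / q := by
    rw [sub_pos, div_lt_one (by linarith)]
    exact hq
  have ht := mul_pos hε hκ
  have := hT.logSobolev_of_smoothingBound ht (hB q hq.le _ ht).1 hκ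
    (sub_le_self _ (div_nonneg two_pos.le (by linarith))) (hT.smoothingBound_of_super hB hq ht) f hf
  rwa [mul_div_cancel_right₀ _ hκ.ne'] at this

lemma logSobolev_of_ultracontractive (hT : IsSymmetricMarkovSemigroup E T) {B : ℝ → ℝ}
    (hB : UltracontractiveWith T B) : LogSobolev E (fun ε => Real.log (B ε)) := by
  intro ε hε f hf
  have := hT.logSobolev_of_smoothingBound hε (hB _ hε).1 one_pos le_rfl
    (hT.smoothingBound_of_ultra hB hε) f hf
  simpa using this

end IsSymmetricMarkovSemigroup

/-! ### Scalar inequalities for powers. -/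

section Scalar

/-- The tangent line of the convex function `x ↦ x^α` at `a`, in the form of Bernoulli's inequality
for `(b - a)/a`. -/
lemma rpow_sub_rpow_le {a b α : ℝ} (ha : 0 ≤ a) (hb : 0 ≤ b) (hα : 1 ≤ α) :
    a ^ α - b ^ α ≤ α * a ^ (α - 1) * (a - b) := by
  rcases ha.eq_or_lt with rfl | ha
  · rcases hα.eq_or_lt with rfl | hα
    · simp
    · rw [Real.zero_rpow (by linarith), Real.zero_rpow (by linarith)]
      simpa using Real.rpow_nonneg hb α
  · have h := one_add_mul_self_le_rpow_one_add (s := (b - a) / a)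
      (by rw [le_div_iff₀ ha]; linarith) hα
    have h1 : 1 + (b - a) / a = b / a := by field_simp; ring
    rw [h1, Real.div_rpow hb ha.le, le_div_iff₀ (Real.rpow_pos_of_pos ha _)] at h
    have h2 : a ^ α = a ^ (α - 1) * a := by
      rw [← Real.rpow_add_one ha.ne', sub_add_cancel]
    have h3 : (1 + α * ((b - a) / a)) * a ^ α = a ^ α + α * a ^ (α - 1) * (b - a) := by
      rw [add_mul, one_mul]
      nth_rw 2 [h2]
      field_simp
    linarith

lemma abs_rpow_sub_rpow_le {a b α M : ℝ} (ha : 0 ≤ a) (hb : 0 ≤ b) (haM : a ≤ M) (hbM : b ≤ M)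
    (hα : 1 ≤ α) : |a ^ α - b ^ α| ≤ α * M ^ (α - 1) * |a - b| := by
  wlog hab : b ≤ a generalizing a b
  · rw [abs_sub_comm, abs_sub_comm a]
    exact this hb ha hbM haM (le_of_not_ge hab)
  rw [abs_of_nonneg (sub_nonneg.2 (Real.rpow_le_rpow hb hab (by linarith))),
    abs_of_nonneg (sub_nonneg.2 hab)]
  refine (rpow_sub_rpow_le ha hb hα).trans ?_
  refine mul_le_mul_of_nonneg_right (mul_le_mul_of_nonneg_left ?_ (by linarith))
    (sub_nonneg.2 hab)
  exact Real.rpow_le_rpow ha haM (by linarith)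

/-- The power function truncated to `[0, M]`. -/
noncomputable def truncPow (M α x : ℝ) : ℝ := (max 0 (min x M)) ^ α

lemma truncPow_zero {M α : ℝ} (hM : 0 ≤ M) (hα : 0 < α) : truncPow M α 0 = 0 := by
  simp [truncPow, min_eq_left hM, Real.zero_rpow hα.ne']

lemma truncPow_of_mem {M α x : ℝ} (h0 : 0 ≤ x) (hM : x ≤ M) : truncPow M α x = x ^ α := by
  simp [truncPow, min_eq_left hM, max_eq_right h0]

lemma abs_trunc_sub_le (M x y : ℝ) : |max 0 (min x M) - max 0 (min y M)| ≤ |x - y| := by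
  refine (abs_max_sub_max_le_max _ _ _ _).trans (max_le (by simp) ?_)
  refine (abs_min_sub_min_le_max _ _ _ _).trans (max_le le_rfl (by simp))

lemma lipschitzWith_truncPow {M α c : ℝ} (hM : 0 ≤ M) (hα : 1 ≤ α) (hc : 0 ≤ c) :
    LipschitzWith (c * (α * M ^ (α - 1))).toNNReal (fun x => c * truncPow M α x) := by
  refine LipschitzWith.of_dist_le_mul fun x y => ?_
  have h0 : 0 ≤ c * (α * M ^ (α - 1)) := by
    have := Real.rpow_nonneg hM (α - 1)
    positivity
  rw [Real.coe_toNNReal _ h0, Real.dist_eq, Real.dist_eq, ← mul_sub, abs_mul, abs_of_nonneg hc,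
    mul_assoc]
  refine mul_le_mul_of_nonneg_left ?_ hc
  refine (abs_rpow_sub_rpow_le (le_max_left _ _) (le_max_left _ _) (max_le hM (min_le_right _ _))
    (max_le hM (min_le_right _ _)) hα).trans ?_
  refine mul_le_mul_of_nonneg_left (abs_trunc_sub_le _ _ _) ?_
  have := Real.rpow_nonneg hM (α - 1)
  positivity

/-- The derivative in the base variable is `(x^{p/2-1} - l)²`. Holding for every `l`, this makes a
quadratic polynomial in `l` nonnegative; its discriminant condition is the scalar Stroock–Varopoulos
inequality. -/
lemma monotone_quadratic {p l : ℝ} (hp : 2 ≤ p) {a b : ℝ} (hb : 0 ≤ b) (hab : b ≤ a) :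
    b ^ (p - 1) / (p - 1) - 4 * l / p * b ^ (p / 2) + l ^ 2 * b ≤
      a ^ (p - 1) / (p - 1) - 4 * l / p * a ^ (p / 2) + l ^ 2 * a := by
  have hmono : MonotoneOn (fun x : ℝ => x ^ (p - 1) / (p - 1) - 4 * l / p * x ^ (p / 2) +
      l ^ 2 * x) (Ici 0) := by
    refine monotoneOn_of_hasDerivWithinAt_nonneg (convex_Ici 0)
      (f' := fun x => (x ^ (p / 2 - 1) - l) ^ 2) ?_ (fun x hx => ?_) (fun x _ => sq_nonneg _)
    · refine ContinuousOn.add (ContinuousOn.sub ?_ ?_) (by fun_prop)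
      · exact ((continuous_id.rpow_const fun _ => Or.inr (by linarith)).div_const _).continuousOn
      · exact ((continuous_id.rpow_const fun _ => Or.inr (by linarith)).const_mul _).continuousOn
    · rw [interior_Ici] at hx
      have hx0 : (0 : ℝ) < x := hx
      have d1 := (Real.hasDerivAt_rpow_const (p := p - 1) (Or.inl hx0.ne')).div_const (p - 1)
      have d2 := (Real.hasDerivAt_rpow_const (p := p / 2) (Or.inl hx0.ne')).const_mul (4 * l / p)
      have d3 := (hasDerivAt_id x).const_mul (l ^ 2)
      refine (((d1.sub d2).add d3).congr_deriv ?_).hasDerivWithinAt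
      have e : x ^ (p - 1 - 1) = (x ^ (p / 2 - 1)) ^ 2 := by
        rw [← Real.rpow_natCast, ← Real.rpow_mul hx0.le]
        congr 1
        push_cast
        ring
      have hp1 : p - 1 ≠ 0 := by linarith
      have hp0 : p ≠ 0 := by linarith
      rw [e]
      field_simp
      ring
  exact hmono hb (hb.trans hab) hab

/-- The scalar Stroock–Varopoulos inequality. -/
lemma sq_rpow_sub_le {p a b : ℝ} (hp : 2 ≤ p) (ha : 0 ≤ a) (hb : 0 ≤ b) :
    (a ^ (p / 2) - b ^ (p / 2)) ^ 2 ≤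
      p ^ 2 / (4 * (p - 1)) * ((a - b) * (a ^ (p - 1) - b ^ (p - 1))) := by
  wlog hab : b ≤ a generalizing a b
  · have := this hb ha (le_of_not_ge hab)
    linarith
  have hp0 : 0 < p := by linarith
  have hp1 : 0 < p - 1 := by linarith
  have h := discrim_le_zero (a := a - b) (b := -(4 / p * (a ^ (p / 2) - b ^ (p / 2))))
    (c := (a ^ (p - 1) - b ^ (p - 1)) / (p - 1)) (fun l => by
      have h1 := monotone_quadratic (l := l) hp hb hab
      have h2 : (a ^ (p - 1) - b ^ (p - 1)) / (p - 1) =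
        a ^ (p - 1) / (p - 1) - b ^ (p - 1) / (p - 1) := sub_div _ _ _
      have h3 : 4 * l / p = 4 / p * l := by ring
      rw [h2]
      rw [h3] at h1
      nlinarith)
  unfold discrim at h
  have h4 : (a ^ (p / 2) - b ^ (p / 2)) ^ 2 * 16 / p ^ 2 ≤
      4 * (a - b) * ((a ^ (p - 1) - b ^ (p - 1)) / (p - 1)) := by
    refine le_trans (le_of_eq ?_) (sub_nonpos.1 h)
    field_simp
    ring
  have h5 := mul_le_mul_of_nonneg_left h4 (show 0 ≤ p ^ 2 / 16 by positivity)
  refine le_trans (le_of_eq ?_) (h5.trans (le_of_eq ?_))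
  · field_simp
  · field_simp
    ring

/-- Truncation is monotone and 1-Lipschitz, so replacing the truncated difference by `a - b` only
increases the right side. -/
lemma sq_truncPow_sub_le {M p : ℝ} (hp : 2 ≤ p) (a b : ℝ) :
    (truncPow M (p / 2) a - truncPow M (p / 2) b) ^ 2 ≤
      (a - b) * (p ^ 2 / (4 * (p - 1)) * truncPow M (p - 1) a -
        p ^ 2 / (4 * (p - 1)) * truncPow M (p - 1) b) := by
  have hc : 0 ≤ p ^ 2 / (4 * (p - 1)) := div_nonneg (sq_nonneg p) (by linarith)
  refine (sq_rpow_sub_le hp (le_max_left 0 (min a M)) (le_max_left 0 (min b M))).trans ?_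
  rw [← mul_sub, mul_left_comm (a - b)]
  refine mul_le_mul_of_nonneg_left ?_ hc
  change _ ≤ (a - b) * ((max 0 (min a M)) ^ (p - 1) - (max 0 (min b M)) ^ (p - 1))
  have key : ∀ x y : ℝ, y ≤ x →
      (max 0 (min x M) - max 0 (min y M)) * ((max 0 (min x M)) ^ (p - 1) -
        (max 0 (min y M)) ^ (p - 1)) ≤
      (x - y) * ((max 0 (min x M)) ^ (p - 1) - (max 0 (min y M)) ^ (p - 1)) := by
    intro x y hxy
    have hm : max 0 (min y M) ≤ max 0 (min x M) := max_le_max le_rfl (min_le_min hxy le_rfl)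
    refine mul_le_mul_of_nonneg_right ?_ (sub_nonneg.2 (Real.rpow_le_rpow (le_max_left _ _) hm
      (by linarith)))
    have := abs_trunc_sub_le M x y
    rw [abs_of_nonneg (sub_nonneg.2 hxy)] at this
    exact (le_abs_self _).trans this
  rcases le_total b a with h | h
  · exact key a b h
  · have := key b a h
    linarith

lemma rpow_mul_abs_log_le {b c M Q : ℝ} (hM : 1 ≤ M) (hb : 0 ≤ b) (hbM : b ≤ M) (hc : 1 / 2 ≤ c)
    (hcQ : c ≤ Q) : b ^ c * |Real.log b| ≤ 2 * M ^ (Q + 1) := by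
  have hM1 : 1 ≤ M ^ (Q + 1) := Real.one_le_rpow hM (by linarith)
  rcases hb.eq_or_lt with rfl | hb
  · simp; linarith
  rcases le_total b 1 with h1 | h1
  · have h2 := Real.abs_log_mul_self_rpow_lt b (1 / 2) hb h1 (by norm_num)
    rw [abs_mul, abs_of_pos (Real.rpow_pos_of_pos hb _)] at h2
    have h3 : b ^ c ≤ b ^ (1 / 2 : ℝ) := Real.rpow_le_rpow_of_exponent_ge hb h1 hc
    have h4 := mul_le_mul_of_nonneg_right h3 (abs_nonneg (Real.log b))
    norm_num at h2 h4
    linarith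
  · have h2 : |Real.log b| ≤ M := by
      rw [abs_of_nonneg (Real.log_nonneg h1)]
      linarith [Real.log_le_sub_one_of_pos hb]
    have h3 : b ^ c ≤ M ^ Q := (Real.rpow_le_rpow hb.le hbM (by linarith)).trans
      (Real.rpow_le_rpow_of_exponent_le hM hcQ)
    rw [Real.rpow_add_one (by linarith)]
    have h4 := mul_le_mul h3 h2 (abs_nonneg _) (by positivity)
    have : 0 ≤ M ^ Q * M := by positivity
    linarith

/-- The mean value bound in the exponent, with `√b` split off: along an integrable nonnegative
function `√b` lies in `L²` and can be paired with an `L²` increment. -/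
lemma abs_rpow_sub_rpow_exponent_le {b x y M Q : ℝ} (hM : 1 ≤ M) (hb : 0 ≤ b) (hbM : b ≤ M)
    (hx : 1 ≤ x) (hy : 1 ≤ y) (hxQ : x ≤ Q) (hyQ : y ≤ Q) :
    |b ^ x - b ^ y| ≤ 2 * M ^ (Q + 1) * |x - y| * √b := by
  wlog hxy : b ^ y ≤ b ^ x generalizing x y
  · rw [abs_sub_comm, abs_sub_comm x]
    exact this hy hx hyQ hxQ (le_of_not_ge hxy)
  rw [abs_of_nonneg (sub_nonneg.2 hxy)]
  rcases hb.eq_or_lt with rfl | hb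
  · simp [Real.zero_rpow (show x ≠ 0 by linarith), Real.zero_rpow (show y ≠ 0 by linarith)]
  have h1 : b ^ x - b ^ y ≤ b ^ x * (|x - y| * |Real.log b|) := by
    have h2 : b ^ y = b ^ x * Real.exp ((y - x) * Real.log b) := by
      rw [mul_comm (y - x), ← Real.rpow_def_of_pos hb, ← Real.rpow_add hb]
      congr 1
      ring
    have h3 := Real.add_one_le_exp ((y - x) * Real.log b)
    have h4 : -((y - x) * Real.log b) ≤ |x - y| * |Real.log b| := by
      rw [← abs_mul, ← neg_mul, neg_sub]
      exact le_abs_self _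
    have h5 : 0 < b ^ x := Real.rpow_pos_of_pos hb x
    rw [h2]
    nlinarith
  have h2 : b ^ x = b ^ (x - 1 / 2) * √b := by
    rw [Real.sqrt_eq_rpow, ← Real.rpow_add hb]
    congr 1
    ring
  have h3 := rpow_mul_abs_log_le hM hb.le hbM (show 1 / 2 ≤ x - 1 / 2 by linarith)
    (show x - 1 / 2 ≤ Q by linarith)
  refine h1.trans ?_
  rw [h2]
  have h4 : 0 ≤ |x - y| * √b := by positivity
  calc b ^ (x - 1 / 2) * √b * (|x - y| * |Real.log b|)
      = (b ^ (x - 1 / 2) * |Real.log b|) * (|x - y| * √b) := by ring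
    _ ≤ 2 * M ^ (Q + 1) * (|x - y| * √b) := mul_le_mul_of_nonneg_right h3 h4
    _ = _ := by ring

/-- First order expansion of `(a, q) ↦ a ^ q` in `a`, with the exponent of the derivative frozen. -/
lemma abs_rpow_sub_sub_le {a b q p M Q : ℝ} (hM : 1 ≤ M) (ha : 0 ≤ a) (haM : a ≤ M) (hb : 0 ≤ b)
    (hbM : b ≤ M) (hq : 2 ≤ q) (hp : 2 ≤ p) (hqQ : q ≤ Q) (hpQ : p ≤ Q) :
    |a ^ q - b ^ q - q * b ^ (p - 1) * (a - b)| ≤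
      Q * Q * M ^ Q * (a - b) ^ 2 + Q * (2 * M ^ (Q + 1)) * |q - p| * (√b * |a - b|) := by
  have h1 : |a ^ q - b ^ q - q * b ^ (q - 1) * (a - b)| ≤ Q * Q * M ^ Q * (a - b) ^ 2 := by
    have e1 := rpow_sub_rpow_le ha hb (show 1 ≤ q by linarith)
    have e2 := rpow_sub_rpow_le hb ha (show 1 ≤ q by linarith)
    rw [abs_of_nonneg (by linarith)]
    have e3 := abs_rpow_sub_rpow_le ha hb haM hbM (show 1 ≤ q - 1 by linarith)
    have e4 : (q - 1) * M ^ (q - 1 - 1) ≤ Q * M ^ Q := by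
      refine mul_le_mul (by linarith) (Real.rpow_le_rpow_of_exponent_le hM (by linarith))
        (by positivity) (by linarith)
    have e5 : (a ^ (q - 1) - b ^ (q - 1)) * (a - b) ≤ Q * M ^ Q * (a - b) ^ 2 := by
      refine (le_abs_self _).trans ?_
      rw [abs_mul, ← sq_abs (a - b), sq, ← mul_assoc]
      exact mul_le_mul_of_nonneg_right
        (e3.trans (mul_le_mul_of_nonneg_right e4 (abs_nonneg _))) (abs_nonneg _)
    have e6 : 0 ≤ Q * M ^ Q * (a - b) ^ 2 := by
      have : 0 ≤ Q := by linarith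
      positivity
    have e7 := mul_le_mul_of_nonneg_left e5 (show 0 ≤ q by linarith)
    have e8 := mul_le_mul_of_nonneg_right hqQ e6
    nlinarith
  have h2 : |q * b ^ (q - 1) * (a - b) - q * b ^ (p - 1) * (a - b)| ≤
      Q * (2 * M ^ (Q + 1)) * |q - p| * (√b * |a - b|) := by
    have e := abs_rpow_sub_rpow_exponent_le hM hb hbM (show 1 ≤ q - 1 by linarith)
      (show 1 ≤ p - 1 by linarith) (show q - 1 ≤ Q by linarith) (show p - 1 ≤ Q by linarith)
    rw [sub_sub_sub_cancel_right] at e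
    rw [← sub_mul, ← mul_sub, abs_mul, abs_mul, abs_of_nonneg (show 0 ≤ q by linarith)]
    calc q * |b ^ (q - 1) - b ^ (p - 1)| * |a - b|
        ≤ Q * (2 * M ^ (Q + 1) * |q - p| * √b) * |a - b| := by
          refine mul_le_mul_of_nonneg_right (mul_le_mul hqQ e (abs_nonneg _) (by linarith))
            (abs_nonneg _)
      _ = _ := by ring
  have h3 := abs_add_le (a ^ q - b ^ q - q * b ^ (q - 1) * (a - b))
    (q * b ^ (q - 1) * (a - b) - q * b ^ (p - 1) * (a - b))
  rw [sub_add_sub_cancel] at h3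
  linarith

end Scalar

/-! ### Differentiating `∫ u(r)^{p(r)}`. -/

section Derivative

variable {X : Type*} [MeasurableSpace X] {μ : Measure X}

lemma integrable_rpow_of_le {f : X → ℝ} (hf : Integrable f μ) {M : ℝ} (h0 : ∀ᵐ x ∂μ, 0 ≤ f x)
    (hM : ∀ᵐ x ∂μ, f x ≤ M) {q : ℝ} (hq : 1 ≤ q) : Integrable (fun x => f x ^ q) μ := by
  refine (hf.const_mul (M ^ (q - 1))).mono' (hf.1.aemeasurable.pow_const _).aestronglyMeasurable ?_
  filter_upwards [h0, hM] with x h0 hM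
  rw [Real.norm_of_nonneg (Real.rpow_nonneg h0 _)]
  calc f x ^ q = f x ^ (q - 1) * f x := by
        rw [← Real.rpow_add_one' h0 (by linarith), sub_add_cancel]
    _ ≤ M ^ (q - 1) * f x :=
        mul_le_mul_of_nonneg_right (Real.rpow_le_rpow h0 hM (by linarith)) h0

lemma hasDerivAt_rpow_exponent {a q : ℝ} (ha : 0 ≤ a) (hq : 0 < q) :
    HasDerivAt (fun q : ℝ => a ^ q) (a ^ q * Real.log a) q := by
  rcases ha.eq_or_lt with rfl | ha
  · refine ((hasDerivAt_const q (0 : ℝ)).congr_of_eventuallyEq ?_).congr_deriv (by simp)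
    filter_upwards [Ioi_mem_nhds hq] with r hr
    exact Real.zero_rpow (ne_of_gt hr)
  · exact (Real.hasStrictDerivAt_const_rpow ha q).hasDerivAt

lemma hasDerivAt_integral_rpow {f : X → ℝ} (hf : Integrable f μ) {M : ℝ} (hM1 : 1 ≤ M)
    (h0 : ∀ᵐ x ∂μ, 0 ≤ f x) (hM : ∀ᵐ x ∂μ, f x ≤ M) {p : ℝ} (hp : 2 ≤ p) :
    HasDerivAt (fun q => ∫ x, f x ^ q ∂μ) (∫ x, f x ^ p * Real.log (f x) ∂μ) p := by
  refine (hasDerivAt_integral_of_dominated_loc_of_deriv_le (s := Metric.ball p (1 / 2))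
    (F' := fun q x => f x ^ q * Real.log (f x)) (bound := fun x => 2 * M ^ (p + 1 + 1) * f x)
    (Metric.ball_mem_nhds p (by norm_num)) (Eventually.of_forall fun q => ?_)
    (integrable_rpow_of_le hf h0 hM (by linarith)) ?_ ?_ (hf.const_mul _) ?_).2
  · exact (hf.1.aemeasurable.pow_const _).aestronglyMeasurable
  · exact ((hf.1.aemeasurable.pow_const _).mul
      (Real.measurable_log.comp_aemeasurable hf.1.aemeasurable)).aestronglyMeasurable
  · filter_upwards [h0, hM] with x h0 hM q hq
    rw [Metric.mem_ball, Real.dist_eq, abs_lt] at hq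
    rw [Real.norm_eq_abs, abs_mul, abs_of_nonneg (Real.rpow_nonneg h0 _)]
    have h := rpow_mul_abs_log_le hM1 h0 hM (show 1 / 2 ≤ q - 1 by linarith [hq.1])
      (show q - 1 ≤ p + 1 by linarith [hq.2])
    calc f x ^ q * |Real.log (f x)| = f x ^ (q - 1) * |Real.log (f x)| * f x := by
          have : f x ^ q = f x ^ (q - 1) * f x := by
            rw [← Real.rpow_add_one' h0 (by linarith [hq.1]), sub_add_cancel]
          rw [this]
          ring
      _ ≤ _ := mul_le_mul_of_nonneg_right h h0
  · filter_upwards [h0] with x h0 q hq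
    rw [Metric.mem_ball, Real.dist_eq, abs_lt] at hq
    exact hasDerivAt_rpow_exponent h0 (by linarith [hq.1])

/-- Derivative of `r ↦ ∫ u(r)^{p(r)}` along a bounded nonnegative curve in `L²`. -/
lemma hasDerivWithinAt_integral_rpow {u : ℝ → Lp ℝ 2 μ} {u' : Lp ℝ 2 μ} {p : ℝ → ℝ} {p' s₀ s M : ℝ}
    (hM1 : 1 ≤ M) (hs : s₀ ≤ s) (h0 : ∀ r, s₀ ≤ r → ∀ᵐ x ∂μ, 0 ≤ u r x)
    (hM : ∀ r, s₀ ≤ r → ∀ᵐ x ∂μ, u r x ≤ M) (hint : ∀ r, s₀ ≤ r → Integrable (u r) μ)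
    (hu : HasDerivAt u u' s) (hp : HasDerivAt p p' s) (hp2 : ∀ r, s₀ ≤ r → 2 ≤ p r)
    {W : Lp ℝ 2 μ} (hW : W =ᵐ[μ] fun x => u s x ^ (p s - 1)) :
    HasDerivWithinAt (fun r => ∫ x, u r x ^ p r ∂μ)
      (p' * (∫ x, u s x ^ p s * Real.log (u s x) ∂μ) + p s * inner ℝ u' W) (Ici s₀) s := by
  -- The integral is split into `∫ u(s)^{p(r)}`, where only the exponent moves (`d1`), the linear
  -- term `p(r) ⟨u(r) - u(s), W⟩` (`d2`), and a remainder `R` that is `O((r-s)²)`.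
  have d1 := (hasDerivAt_integral_rpow (hint s hs) hM1 (h0 s hs) (hM s hs) (hp2 s hs)).comp s hp
  have d2 := hp.mul ((hu.sub_const (u s)).inner ℝ (hasDerivAt_const s W))
  set Q := p s + 1 with hQ
  have hQ0 : 0 ≤ Q := by linarith [hp2 s hs]
  have hsq : MemLp (fun x => √(u s x)) 2 μ := by
    rw [memLp_two_iff_integrable_sq (hint s hs).1.aemeasurable.sqrt.aestronglyMeasurable]
    refine (hint s hs).congr ?_
    filter_upwards [h0 s hs] with x hx
    rw [Real.sq_sqrt hx]
  obtain ⟨V, hV⟩ : ∃ V : Lp ℝ 2 μ, V =ᵐ[μ] fun x => √(u s x) := ⟨hsq.toLp, hsq.coeFn_toLp⟩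
  set N := ‖V‖ with hN
  set R : ℝ → ℝ := fun r => (∫ x, u r x ^ p r ∂μ) - (∫ x, u s x ^ p r ∂μ) -
    p r * inner ℝ (u r - u s) W with hR
  have hpQ : ∀ᶠ r in 𝓝[Ici s₀] s, p r ≤ Q :=
    nhdsWithin_le_nhds (hp.continuousAt.eventually (ge_mem_nhds (by linarith)))
  have hRle : ∀ᶠ r in 𝓝[Ici s₀] s, ‖R r‖ ≤ Q * Q * M ^ Q * ‖u r - u s‖ ^ 2 +
      Q * (2 * M ^ (Q + 1)) * |p r - p s| * (N * ‖u r - u s‖) := by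
    filter_upwards [hpQ, self_mem_nhdsWithin] with r hr hrs
    have i1 := integrable_rpow_of_le (hint r hrs) (h0 r hrs) (hM r hrs)
      (show 1 ≤ p r by linarith [hp2 r hrs])
    have i2 := integrable_rpow_of_le (hint s hs) (h0 s hs) (hM s hs)
      (show 1 ≤ p r by linarith [hp2 r hrs])
    have i3 := (L2.integrable_inner (𝕜 := ℝ) (u r - u s) W).const_mul (p r)
    have i4 := L2.integrable_inner (𝕜 := ℝ) (u r - u s) (u r - u s)
    have i5 := L2.integrable_inner (𝕜 := ℝ) V |u r - u s|
    have e1 : R r = ∫ x, (u r x ^ p r - u s x ^ p r - p r * inner ℝ ((u r - u s) x) (W x)) ∂μ := by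
      have i12 : Integrable (fun x => u r x ^ p r - u s x ^ p r) μ := i1.sub i2
      rw [integral_sub i12 i3, integral_sub i1 i2, integral_const_mul]
      rfl
    have e2 : Q * Q * M ^ Q * ‖u r - u s‖ ^ 2 + Q * (2 * M ^ (Q + 1)) * |p r - p s| *
        inner ℝ V |u r - u s| = ∫ x, (Q * Q * M ^ Q * inner ℝ ((u r - u s) x) ((u r - u s) x)
          + Q * (2 * M ^ (Q + 1)) * |p r - p s| * inner ℝ (V x) (|u r - u s| x)) ∂μ := by
      rw [integral_add (i4.const_mul _) (i5.const_mul _), integral_const_mul, integral_const_mul,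
        ← real_inner_self_eq_norm_sq]
      rfl
    have e3 : ‖R r‖ ≤ Q * Q * M ^ Q * ‖u r - u s‖ ^ 2 + Q * (2 * M ^ (Q + 1)) * |p r - p s| *
        inner ℝ V |u r - u s| := by
      rw [e1, e2]
      refine norm_integral_le_of_norm_le ((i4.const_mul _).add (i5.const_mul _)) ?_
      filter_upwards [h0 r hrs, hM r hrs, h0 s hs, hM s hs, hW, Lp.coeFn_sub (u r) (u s),
        hV, Lp.coeFn_abs (u r - u s)] with x a1 a2 b1 b2 hW hd hq ha
      rw [ha, hq, hW, hd, Pi.sub_apply, Real.norm_eq_abs]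
      have := abs_rpow_sub_sub_le hM1 a1 a2 b1 b2 (hp2 r hrs) (hp2 s hs) hr
        (show p s ≤ Q by linarith)
      simp only [RCLike.inner_apply, conj_trivial]
      refine le_trans (le_of_eq ?_) (this.trans (le_of_eq ?_))
      · congr 1
        ring
      · ring
    refine e3.trans (add_le_add_right (mul_le_mul_of_nonneg_left ?_ (by positivity)) _)
    refine (real_inner_le_norm _ _).trans (le_of_eq ?_)
    rw [norm_abs_eq_norm]
  have d3 : HasDerivWithinAt R 0 (Ici s₀) s := by
    have hus : (fun r => u r - u s) =O[𝓝[Ici s₀] s] fun r => r - s :=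
      hu.hasDerivWithinAt.hasFDerivWithinAt.isBigO_sub
    have hps : (fun r => p r - p s) =O[𝓝[Ici s₀] s] fun r => r - s :=
      hp.hasDerivWithinAt.hasFDerivWithinAt.isBigO_sub
    have hlit : (fun r => (r - s) * (r - s)) =o[𝓝[Ici s₀] s] fun r => r - s := by
      have h1 : (fun r => r - s) =o[𝓝[Ici s₀] s] fun _ => (1 : ℝ) := by
        rw [Asymptotics.isLittleO_one_iff]
        have : Tendsto (fun r => r - s) (𝓝 s) (𝓝 (s - s)) := tendsto_id.sub_const s
        rw [sub_self] at this
        exact this.mono_left nhdsWithin_le_nhds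
      simpa using h1.mul_isBigO (Asymptotics.isBigO_refl (fun r => r - s) (𝓝[Ici s₀] s))
    have hRs : R s = 0 := by simp [hR]
    rw [hasDerivWithinAt_iff_isLittleO]
    simp only [hRs, sub_zero, smul_zero]
    refine (Asymptotics.IsBigO.of_norm_eventuallyLE (g := fun r => Q * Q * M ^ Q * ‖u r - u s‖ ^ 2 +
      Q * (2 * M ^ (Q + 1)) * |p r - p s| * (N * ‖u r - u s‖)) ?_).trans_isLittleO
      (Asymptotics.IsBigO.trans_isLittleO ?_ hlit)
    · exact hRle
    · refine Asymptotics.IsBigO.add ?_ ?_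
      · simp only [sq]
        exact (hus.norm_left.mul hus.norm_left).const_mul_left _
      · have := (hps.abs_left.const_mul_left (Q * (2 * M ^ (Q + 1)))).mul
          (hus.norm_left.const_mul_left N)
        exact this
  refine (((d1.add d2).hasDerivWithinAt.add d3).congr_of_eventuallyEq ?_ ?_).congr_deriv ?_
  · filter_upwards with r
    simp [hR]
  · simp [hR]
  · simp
    ring

end Derivative

/-! ### Stroock–Varopoulos along the semigroup, and Gross's hypercontractivity argument. -/

namespace IsSymmetricMarkovSemigroup

variable {X : Type*} [MeasurableSpace X] {μ : Measure X} {E : ClosedForm μ}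
  {T : ℝ → Lp ℝ 2 μ →L[ℝ] Lp ℝ 2 μ}

/-- The semigroup preserves integrability of nonnegative functions. -/
lemma integrable_apply (hT : IsSymmetricMarkovSemigroup E T) {t : ℝ} (ht : 0 ≤ t) {f : Lp ℝ 2 μ}
    (hf : 0 ≤ f) (hfi : Integrable f μ) : Integrable (T t f) μ := by
  have hF := hT.positivity t ht f hf
  set F := T t f with hFdef
  have hm : Measurable F := (Lp.stronglyMeasurable F).measurable
  -- These sets have finite measure by Chebyshev and exhaust `{F > 0}`. Symmetry and `T t 1_A ≤ 1`
  -- give `∫_A F = ⟨f, T t 1_A⟩ ≤ ∫ f`.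
  set A : ℕ → Set X := fun n => {x | 1 / ((n : ℝ) + 1) ≤ F x} with hA
  have hAm : ∀ n, MeasurableSet (A n) := fun n => measurableSet_le measurable_const hm
  have hAμ : ∀ n, μ (A n) ≠ ⊤ := by
    intro n
    refine ((measure_mono fun x hx => ?_).trans_lt
      ((Lp.memLp F).integrable_sq.measure_ge_lt_top (ε := (1 / ((n : ℝ) + 1)) ^ 2)
        (by positivity))).ne
    have h0 : (0 : ℝ) ≤ 1 / ((n : ℝ) + 1) := by positivity
    exact pow_le_pow_left₀ h0 hx 2
  refine (integrable_of_tendsto_of_integral_le (h := fun n => (A n).indicator F)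
    (c := fun _ => ∫ x, f x ∂μ) (C := ∫ x, f x ∂μ) (fun n => ?_) (fun n => ?_) ?_ ?_
    tendsto_const_nhds).1
  · exact (integrableOn_Lp_of_measure_ne_top F (by norm_num) (hAμ n)).integrable_indicator (hAm n)
  · filter_upwards [(Lp.coeFn_nonneg F).2 hF] with x hx
    exact indicator_apply_nonneg fun _ => hx
  · filter_upwards [(Lp.coeFn_nonneg F).2 hF] with x hx
    rcases (show 0 ≤ F x from hx).eq_or_lt with h | h
    · have : ∀ n, (A n).indicator F x = 0 := fun n => by
        by_cases hx : x ∈ A n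
        · rw [indicator_of_mem hx, ← h]
        · rw [indicator_of_notMem hx]
      simp [this, ← h]
    · refine tendsto_const_nhds.congr' ?_
      filter_upwards [(tendsto_one_div_add_atTop_nhds_zero_nat (𝕜 := ℝ)).eventually
        (ge_mem_nhds h)] with n hn
      exact (indicator_of_mem (s := A n) hn _).symm
  · refine Eventually.of_forall fun n => ?_
    rw [integral_indicator (hAm n), ← L2.inner_indicatorConstLp_one (hAm n) (hAμ n),
      real_inner_comm, hFdef, hT.inner_apply_comm ht, L2.inner_def]
    refine integral_mono_ae (L2.integrable_inner _ _) hfi ?_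
    have hb := hT.ae_abs_apply_le ht zero_le_one
      (f := indicatorConstLp 2 (hAm n) (hAμ n) (1 : ℝ)) (by
        filter_upwards [indicatorConstLp_coeFn (p := 2) (hs := hAm n) (hμs := hAμ n)
          (c := (1 : ℝ))] with x hx
        rw [hx]
        by_cases h : x ∈ A n <;> simp [h])
    filter_upwards [hb, (Lp.coeFn_nonneg f).2 hf] with x h1 h2
    have h3 := (abs_le.1 h1).2
    have h4 : 0 ≤ f x := h2
    simp only [RCLike.inner_apply, conj_trivial]
    nlinarith

/-- The Stroock–Varopoulos inequality along the semigroup. -/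
lemma energy_truncPow_le (hT : IsSymmetricMarkovSemigroup E T) {s M p : ℝ} (hs : 0 < s)
    (hM : 0 ≤ M) (hp : 2 ≤ p) (f : Lp ℝ 2 μ) {v W : Lp ℝ 2 μ}
    (hv : v =ᵐ[μ] fun x => truncPow M (p / 2) (T s f x))
    (hW : W =ᵐ[μ] fun x => truncPow M (p - 1) (T s f x)) :
    ∃ hv : v ∈ E.domain, E.energy ⟨v, hv⟩ ≤
      p ^ 2 / (4 * (p - 1)) * -inner ℝ (deriv (fun t => T t f) s) W := by
  have hc : 0 ≤ p ^ 2 / (4 * (p - 1)) := div_nonneg (sq_nonneg p) (by linarith)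
  have L1 := lipschitzWith_truncPow hM (show 1 ≤ p / 2 by linarith) zero_le_one
  have L2 := lipschitzWith_truncPow hM (show 1 ≤ p - 1 by linarith) hc
  have z1 : 1 * truncPow M (p / 2) 0 = 0 := by rw [truncPow_zero hM (by linarith), mul_zero]
  have z2 : p ^ 2 / (4 * (p - 1)) * truncPow M (p - 1) 0 = 0 := by
    rw [truncPow_zero hM (by linarith), mul_zero]
  have e1 : L1.compLp z1 (T s f) = v := by
    refine Lp.ext ?_
    filter_upwards [L1.coeFn_compLp z1 (T s f), hv] with x h1 h2
    rw [h1, h2, Function.comp, one_mul]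
  have e2 : L2.compLp z2 (T s f) = (p ^ 2 / (4 * (p - 1))) • W := by
    refine Lp.ext ?_
    filter_upwards [L2.coeFn_compLp z2 (T s f), hW, Lp.coeFn_smul (p ^ 2 / (4 * (p - 1))) W]
      with x h1 h2 h3
    rw [h1, h3, Pi.smul_apply, h2, Function.comp, smul_eq_mul]
  -- The approximate energy of `v` is compared with the pairing of `T s f - T (s+h) f` and
  -- `p²/(4(p-1)) W`, whose quotient by `h` tends to a derivative at `s > 0`.
  refine hT.mem_domain_of_tendsto v (fun h => (inner ℝ (T s f) ((p ^ 2 / (4 * (p - 1))) • W) -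
    inner ℝ (T (s + h) f) ((p ^ 2 / (4 * (p - 1))) • W)) / h) _ (fun h hh => ?_)
    (fun h hpos hlim => ?_)
  · have := hT.inner_sub_compLp_le hh.le L1 L2 z1 z2 (fun a b => by
      simpa using sq_truncPow_sub_le (M := M) hp a b) (T s f)
    rw [e1, e2, ← hT.apply_add hs.le hh.le] at this
    exact div_le_div_of_nonneg_right this hh.le
  · have := hT.tendsto_slope hs f ((p ^ 2 / (4 * (p - 1))) • W) hpos hlim
    rwa [inner_smul_right (deriv _ _), ← mul_neg] at this

/-- The logarithmic Sobolev inequality with parameter `ε` and constant `b`. -/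
def LogSobolevAt (E : ClosedForm μ) (ε b : ℝ) : Prop :=
  ∀ f : E.domain, MemLp (f : Lp ℝ 2 μ) 1 μ →
    entropy μ (fun x => (f : Lp ℝ 2 μ) x ^ 2) ≤
      2 * b * ‖(f : Lp ℝ 2 μ)‖ ^ 2 + 2 * ε * E.energy f

lemma ae_mem_Icc_apply (hT : IsSymmetricMarkovSemigroup E T) {t M : ℝ} (ht : 0 ≤ t) (hM : 0 ≤ M)
    {f : Lp ℝ 2 μ} (hf : 0 ≤ f) (hfM : ∀ᵐ x ∂μ, f x ≤ M) :
    ∀ᵐ x ∂μ, 0 ≤ T t f x ∧ T t f x ≤ M := by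
  have h := hT.ae_abs_apply_le ht hM (f := f) (by
    filter_upwards [hfM, (Lp.coeFn_nonneg f).2 hf] with x h1 h2
    rwa [abs_of_nonneg (show 0 ≤ f x from h2)])
  filter_upwards [h, (Lp.coeFn_nonneg _).2 (hT.positivity t ht f hf)] with x h1 h2
  exact ⟨h2, (le_abs_self _).trans h1⟩

/-- The differential inequality behind hypercontractivity. -/
lemma log_sobolev_derivative_le (hT : IsSymmetricMarkovSemigroup E T) {ε b s M p : ℝ} (hε : 0 < ε)
    (hLS : LogSobolevAt E ε b) (hs : 0 < s) (hM : 0 ≤ M) (hp : 2 ≤ p) {f : Lp ℝ 2 μ} (hf : 0 ≤ f)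
    (hfM : ∀ᵐ x ∂μ, f x ≤ M) (hfi : Integrable f μ) {W : Lp ℝ 2 μ}
    (hW : W =ᵐ[μ] fun x => T s f x ^ (p - 1)) :
    2 * (p - 1) / ε * (p * ∫ x, T s f x ^ p * Real.log (T s f x) ∂μ) +
        p ^ 2 * inner ℝ (deriv (fun t => T t f) s) W ≤
      2 * (p - 1) / ε * ((∫ x, T s f x ^ p ∂μ) * Real.log (∫ x, T s f x ^ p ∂μ) +
        2 * b * ∫ x, T s f x ^ p ∂μ) := by
  have hb := hT.ae_mem_Icc_apply hs.le hM hf hfM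
  have hi := hT.integrable_apply hs.le hf hfi
  have hp2 : 1 ≤ p / 2 := by linarith
  have L := lipschitzWith_truncPow hM hp2 zero_le_one
  have z : 1 * truncPow M (p / 2) 0 = 0 := by rw [truncPow_zero hM (by linarith), mul_zero]
  obtain ⟨v, hv⟩ : ∃ v : Lp ℝ 2 μ, v =ᵐ[μ] fun x => truncPow M (p / 2) (T s f x) := by
    refine ⟨L.compLp z (T s f), ?_⟩
    filter_upwards [L.coeFn_compLp z (T s f)] with x hx
    rw [hx, Function.comp, one_mul]
  obtain ⟨hvD, hvE⟩ := hT.energy_truncPow_le hs hM hp f hv (W := W) (by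
    filter_upwards [hW, hb] with x h1 h2
    rw [h1, truncPow_of_mem h2.1 h2.2])
  have hv' : v =ᵐ[μ] fun x => T s f x ^ (p / 2) := by
    filter_upwards [hv, hb] with x h1 h2
    rw [h1, truncPow_of_mem h2.1 h2.2]
  have hvsq : (fun x => v x ^ 2) =ᵐ[μ] fun x => T s f x ^ p := by
    filter_upwards [hv', hb] with x h1 h2
    rw [h1, ← Real.rpow_natCast, ← Real.rpow_mul h2.1]
    congr 1
    push_cast
    ring
  have hls := hLS ⟨v, hvD⟩ (memLp_one_iff_integrable.2 ((integrable_congr hv').2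
    (integrable_rpow_of_le hi (hb.mono fun x h => h.1) (hb.mono fun x h => h.2) hp2)))
  have hlog : (fun x => v x ^ 2 * Real.log (v x ^ 2)) =ᵐ[μ]
      fun x => p * (T s f x ^ p * Real.log (T s f x)) := by
    filter_upwards [hvsq, hb] with x h1 h2
    rw [h1]
    rcases h2.1.eq_or_lt with h0 | h0
    · rw [← h0, Real.zero_rpow (by linarith)]
      simp
    · rw [Real.log_rpow h0]
      ring
  rw [entropy_sq, ← integral_sq_eq_norm_sq, integral_congr_ae hvsq, integral_congr_ae hlog,
    integral_const_mul] at hls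
  have hp1 : 0 < p - 1 := by linarith
  set Z := ∫ x, T s f x ^ p ∂μ
  set I := ∫ x, T s f x ^ p * Real.log (T s f x) ∂μ
  set D := inner ℝ (deriv (fun t => T t f) s) W
  -- The factor `2(p-1)/ε` is the future `p'`; it turns the energy coefficient into exactly `p²`, so
  -- the energy cancels against the dissipation term.
  have h1 : 2 * (p - 1) / ε * (2 * ε * E.energy ⟨v, hvD⟩) ≤
      2 * (p - 1) / ε * (2 * ε * (p ^ 2 / (4 * (p - 1)) * -D)) := by gcongr
  have h2 : 2 * (p - 1) / ε * (2 * ε * (p ^ 2 / (4 * (p - 1)) * -D)) = -(p ^ 2 * D) := by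
    field_simp
    ring
  have h3 := mul_le_mul_of_nonneg_left hls (show 0 ≤ 2 * (p - 1) / ε by positivity)
  rw [mul_sub, mul_add] at h3
  rw [mul_add]
  linarith

/-- Hypercontractivity from one logarithmic Sobolev inequality, in integrated form. -/
lemma hypercontractive_integral (hT : IsSymmetricMarkovSemigroup E T) {ε b σ p₀ p₁ M : ℝ}
    (hε : 0 < ε) (hLS : LogSobolevAt E ε b) (hσ : 0 < σ) (hp₀ : 2 ≤ p₀) (hp : p₀ ≤ p₁)
    (hM1 : 1 ≤ M) {f : Lp ℝ 2 μ} (hf : 0 ≤ f) (hfM : ∀ᵐ x ∂μ, f x ≤ M) (hfi : Integrable f μ) :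
    (∫ x, T (σ + ε / 2 * Real.log ((p₁ - 1) / (p₀ - 1))) f x ^ p₁ ∂μ) ^ p₁⁻¹ ≤
      Real.exp (2 * b * (p₀⁻¹ - p₁⁻¹)) * (∫ x, T σ f x ^ p₀ ∂μ) ^ p₀⁻¹ := by
  have hM : 0 ≤ M := by linarith
  have hp₀1 : 0 < p₀ - 1 := by linarith
  have hp₁1 : 0 < p₁ - 1 := by linarith
  set σ₁ := σ + ε / 2 * Real.log ((p₁ - 1) / (p₀ - 1)) with hσ₁
  have hσσ₁ : σ ≤ σ₁ := by
    have : 0 ≤ Real.log ((p₁ - 1) / (p₀ - 1)) :=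
      Real.log_nonneg ((one_le_div hp₀1).2 (by linarith))
    have : 0 ≤ ε / 2 * Real.log ((p₁ - 1) / (p₀ - 1)) := by positivity
    linarith
  -- The solution of `p' = 2(p-1)/ε` with `p(σ) = p₀`; it reaches `p₁` at time `σ₁`.
  set p : ℝ → ℝ := fun s => 1 + (p₀ - 1) * Real.exp (2 * (s - σ) / ε) with hpdef
  have pσ : p σ = p₀ := by simp [hpdef]
  have pσ₁ : p σ₁ = p₁ := by
    have : 2 * (σ₁ - σ) / ε = Real.log ((p₁ - 1) / (p₀ - 1)) := by
      rw [hσ₁]; field_simp; ring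
    simp only [hpdef]
    rw [this, Real.exp_log (by positivity)]
    field_simp
    ring
  have hp2 : ∀ s, σ ≤ s → 2 ≤ p s := by
    intro s hs
    have h1 : 1 ≤ Real.exp (2 * (s - σ) / ε) := Real.one_le_exp (by
      have : 0 ≤ s - σ := sub_nonneg.2 hs
      positivity)
    simp only [hpdef]
    nlinarith
  have hpd : ∀ s, HasDerivAt p (2 * (p s - 1) / ε) s := by
    intro s
    have h1 : HasDerivAt (fun s : ℝ => 2 * (s - σ) / ε) (2 / ε) s := by
      simpa using (((hasDerivAt_id s).sub_const σ).const_mul 2).div_const ε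
    refine ((h1.exp.const_mul (p₀ - 1)).const_add 1).congr_deriv ?_
    simp only [hpdef]
    ring
  set Z : ℝ → ℝ := fun s => ∫ x, T s f x ^ p s ∂μ with hZ
  have hb : ∀ s, σ ≤ s → ∀ᵐ x ∂μ, 0 ≤ T s f x ∧ T s f x ≤ M :=
    fun s hs => hT.ae_mem_Icc_apply (hσ.le.trans hs) hM hf hfM
  have hi : ∀ s, σ ≤ s → Integrable (T s f) μ :=
    fun s hs => hT.integrable_apply (hσ.le.trans hs) hf hfi
  have hZ0 : ∀ s, σ ≤ s → 0 ≤ Z s := fun s hs => integral_nonneg_of_ae (by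
    filter_upwards [hb s hs] with x hx
    exact Real.rpow_nonneg hx.1 _)
  suffices hmain : (Z σ₁) ^ (p σ₁)⁻¹ ≤
      Real.exp (2 * b * ((p σ)⁻¹ - (p σ₁)⁻¹)) * (Z σ) ^ (p σ)⁻¹ by
    simp only [hZ, pσ, pσ₁] at hmain
    exact hmain
  rcases (hZ0 σ₁ hσσ₁).eq_or_lt with h0 | h0
  · rw [← h0, Real.zero_rpow (inv_ne_zero (by linarith [hp2 σ₁ hσσ₁]))]
    have := hZ0 σ le_rfl
    positivity
  -- If `Z` vanished at some `s`, then `T s f = 0`, and by the semigroup law `Z σ₁ = 0`. Positivity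
  -- is needed to take `log Z`.
  have hZpos : ∀ s ∈ Icc σ σ₁, 0 < Z s := by
    intro s hs
    refine (hZ0 s hs.1).lt_of_ne fun h => h0.ne' ?_
    have h1 : (fun x => T s f x ^ p s) =ᵐ[μ] 0 :=
      (integral_eq_zero_iff_of_nonneg_ae (by
        filter_upwards [hb s hs.1] with x hx
        exact Real.rpow_nonneg hx.1 _) (integrable_rpow_of_le (hi s hs.1)
          ((hb s hs.1).mono fun x h => h.1) ((hb s hs.1).mono fun x h => h.2)
          (by linarith [hp2 s hs.1]))).1 h.symm
    have h2 : T s f = 0 := by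
      refine Lp.ext ?_
      filter_upwards [h1, hb s hs.1, Lp.coeFn_zero ℝ 2 μ] with x h1 h2 h3
      rw [h3]
      exact ((Real.rpow_eq_zero_iff_of_nonneg h2.1).1 h1).1
    have h3 : T σ₁ f = 0 := by
      have := hT.apply_add (hσ.le.trans hs.1) (sub_nonneg.2 hs.2) f
      rw [add_sub_cancel, h2, map_zero] at this
      exact this
    have h4 : (fun x => T σ₁ f x ^ p σ₁) =ᵐ[μ] fun _ => (0 : ℝ) := by
      rw [h3]
      filter_upwards [Lp.coeFn_zero ℝ 2 μ] with x hx
      rw [hx, Pi.zero_apply, Real.zero_rpow (by linarith [hp2 σ₁ hσσ₁])]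
    simp only [hZ]
    rw [integral_congr_ae h4, integral_zero]
  have hZd : ∀ s, σ ≤ s → ∃ D, HasDerivWithinAt Z D (Ici σ) s ∧
      p s * D ≤ 2 * (p s - 1) / ε * (Z s * Real.log (Z s) + 2 * b * Z s) := by
    intro s hs
    have hs0 : 0 < s := hσ.trans_le hs
    have L := lipschitzWith_truncPow hM (show 1 ≤ p s - 1 by linarith [hp2 s hs]) zero_le_one
    have z : 1 * truncPow M (p s - 1) 0 = 0 := by
      rw [truncPow_zero hM (by linarith [hp2 s hs]), mul_zero]
    obtain ⟨W, hW⟩ : ∃ W : Lp ℝ 2 μ, W =ᵐ[μ] fun x => T s f x ^ (p s - 1) := by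
      refine ⟨L.compLp z (T s f), ?_⟩
      filter_upwards [L.coeFn_compLp z (T s f), hb s hs] with x hx hx'
      rw [hx, Function.comp, one_mul, truncPow_of_mem hx'.1 hx'.2]
    refine ⟨_, hasDerivWithinAt_integral_rpow (u := fun s => T s f) hM1 hs
      (fun r hr => (hb r hr).mono fun x h => h.1) (fun r hr => (hb r hr).mono fun x h => h.2) hi
      (hT.hasDerivAt hs0 f) (hpd s) hp2 hW, ?_⟩
    have := hT.log_sobolev_derivative_le hε hLS hs0 hM (hp2 s hs) hf hfM hfi hW
    simp only [hZ]
    refine le_trans (le_of_eq ?_) this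
    ring
  have hanti : AntitoneOn (fun s => (Real.log (Z s) + 2 * b) / p s) (Icc σ σ₁) := by
    choose! D hD hDle using hZd
    have hF : ∀ s ∈ Icc σ σ₁, HasDerivWithinAt (fun s => (Real.log (Z s) + 2 * b) / p s)
        ((D s / Z s * p s - (Real.log (Z s) + 2 * b) * (2 * (p s - 1) / ε)) / p s ^ 2)
        (Icc σ σ₁) s := by
      intro s hs
      have h1 := (hD s hs.1).mono Icc_subset_Ici_self (t := Ici σ) (s := Icc σ σ₁)
      exact ((h1.log (hZpos s hs).ne').add_const (2 * b)).div (hpd s).hasDerivWithinAt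
        (by linarith [hp2 s hs.1])
    refine antitoneOn_of_hasDerivWithinAt_nonpos (convex_Icc σ σ₁)
      (fun s hs => (hF s hs).continuousWithinAt)
      (fun s hs => (hF s (interior_subset hs)).mono interior_subset) (fun s hs => ?_)
    replace hs := interior_subset hs
    refine div_nonpos_of_nonpos_of_nonneg ?_ (sq_nonneg _)
    have h1 := hDle s hs.1
    have h2 := hZpos s hs
    have h3 : D s / Z s * p s ≤ 2 * (p s - 1) / ε * (Real.log (Z s) + 2 * b) := by
      rw [div_mul_eq_mul_div, div_le_iff₀ h2]
      linarith
    linarith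
  have h1 := hanti (left_mem_Icc.2 hσσ₁) (right_mem_Icc.2 hσσ₁) hσσ₁
  have hz0 := hZpos σ (left_mem_Icc.2 hσσ₁)
  rw [Real.rpow_def_of_pos h0, Real.rpow_def_of_pos hz0, ← Real.exp_add]
  refine Real.exp_le_exp.2 ?_
  simp only [div_eq_mul_inv] at h1
  linarith

end IsSymmetricMarkovSemigroup

/-! ### Comparison of `L^q` norms. -/

section LpNorms

variable {X : Type*} [MeasurableSpace X] {μ : Measure X}

/-- Integrate `|g|^q ≤ K^{q-2} |g|²`. -/
lemma eLpNorm_le_of_le_two_of_le_top {g : X → ℝ} {K : ENNReal} (h2 : eLpNorm g 2 μ ≤ K)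
    (htop : eLpNorm g ⊤ μ ≤ K) {q : ℝ} (hq : 2 ≤ q) : eLpNorm g (ENNReal.ofReal q) μ ≤ K := by
  have hq0 : 0 < q := by linarith
  rw [eLpNorm_exponent_top] at htop
  rw [eLpNorm_eq_lintegral_rpow_enorm_toReal two_ne_zero ENNReal.ofNat_ne_top] at h2
  rw [eLpNorm_eq_lintegral_rpow_enorm_toReal (by simpa using hq0) ENNReal.ofReal_ne_top,
    ENNReal.toReal_ofReal hq0.le]
  have h2' : ∫⁻ x, ‖g x‖ₑ ^ (2 : ℝ) ∂μ ≤ K ^ (2 : ℝ) := by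
    have := ENNReal.rpow_le_rpow h2 (show (0 : ℝ) ≤ 2 by norm_num)
    rw [← ENNReal.rpow_mul] at this
    simpa using this
  have h : ∫⁻ x, ‖g x‖ₑ ^ q ∂μ ≤ K ^ q := by
    have e : ∀ a : ENNReal, a ^ q = a ^ (q - 2) * a ^ (2 : ℝ) := fun a => by
      rw [← ENNReal.rpow_add_of_nonneg _ _ (by linarith) (by norm_num), sub_add_cancel]
    by_cases hK : K = ⊤
    · rw [hK, ENNReal.top_rpow_of_pos hq0]
      exact le_top
    calc ∫⁻ x, ‖g x‖ₑ ^ q ∂μ ≤ ∫⁻ x, K ^ (q - 2) * ‖g x‖ₑ ^ (2 : ℝ) ∂μ := by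
          refine lintegral_mono_ae ?_
          filter_upwards [ae_le_eLpNormEssSup (f := g) (μ := μ)] with x hx
          rw [e]
          exact mul_le_mul_left (ENNReal.rpow_le_rpow (hx.trans htop) (by linarith)) _
      _ = K ^ (q - 2) * ∫⁻ x, ‖g x‖ₑ ^ (2 : ℝ) ∂μ :=
          lintegral_const_mul' _ _ (ENNReal.rpow_ne_top_of_nonneg (by linarith) hK)
      _ ≤ K ^ q := by
          rw [e K]
          gcongr
  calc (∫⁻ x, ‖g x‖ₑ ^ q ∂μ) ^ (1 / q) ≤ (K ^ q) ^ (1 / q) :=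
        ENNReal.rpow_le_rpow h (by positivity)
    _ = K := by rw [← ENNReal.rpow_mul, mul_one_div_cancel hq0.ne', ENNReal.rpow_one]

/-- For `a > K`, Chebyshev in `L^{p n}` gives `μ{|g| ≥ a} ≤ (K/a)^{p n}`, which tends to `0`. -/
lemma eLpNorm_top_le_of_forall_le {g : X → ℝ} (hg : AEStronglyMeasurable g μ) {K : ENNReal}
    {p : ℕ → ℕ} (hp : ∀ n, n < p n) (h : ∀ n, eLpNorm g (p n) μ ≤ K) : eLpNorm g ⊤ μ ≤ K := by
  rw [eLpNorm_exponent_top]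
  refine le_of_forall_gt_imp_ge_of_dense fun a ha => ?_
  rcases eq_or_ne a ⊤ with rfl | hatop
  · exact le_top
  have ha0 : a ≠ 0 := (pos_of_gt ha).ne'
  have hKa : K / a < 1 := by
    rw [ENNReal.div_lt_iff (Or.inl ha0) (Or.inl hatop), one_mul]
    exact ha
  have hμ : ∀ n, μ {x | a ≤ ‖g x‖ₑ} ≤ (K / a) ^ n := by
    intro n
    have h1 := mul_meas_ge_le_pow_eLpNorm' μ (p := p n)
      (by exact_mod_cast (Nat.zero_lt_of_lt (hp n)).ne') (ENNReal.natCast_ne_top _) hg a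
    rw [ENNReal.toReal_natCast, ENNReal.rpow_natCast, ENNReal.rpow_natCast] at h1
    have h2 : μ {x | a ≤ ‖g x‖ₑ} ≤ (K / a) ^ p n := by
      rw [div_eq_mul_inv, mul_pow, ← ENNReal.inv_pow, ← div_eq_mul_inv,
        ENNReal.le_div_iff_mul_le (Or.inl (pow_ne_zero _ ha0)) (Or.inl (ENNReal.pow_ne_top hatop)),
        mul_comm]
      exact h1.trans (pow_le_pow_left' (h n) _)
    exact h2.trans (pow_le_pow_right_of_le_one' hKa.le (hp n).le)
  have h0 : μ {x | a ≤ ‖g x‖ₑ} = 0 := le_antisymm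
    (ge_of_tendsto' (ENNReal.tendsto_pow_atTop_nhds_zero_of_lt_one hKa) hμ) zero_le
  refine essSup_le_of_ae_le _ ?_
  filter_upwards [measure_eq_zero_iff_ae_notMem.1 h0] with x hx
  exact (not_le.1 hx).le

lemma integral_rpow_two (f : Lp ℝ 2 μ) : (∫ x, f x ^ (2 : ℝ) ∂μ) ^ (2 : ℝ)⁻¹ = ‖f‖ := by
  simp only [Real.rpow_two, integral_sq_eq_norm_sq]
  exact_mod_cast Real.pow_rpow_inv_natCast (norm_nonneg f) two_ne_zero

end LpNorms

/-! ### From logarithmic Sobolev inequalities to contractivity. -/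

namespace IsSymmetricMarkovSemigroup

variable {X : Type*} [MeasurableSpace X] {μ : Measure X} {E : ClosedForm μ}
  {T : ℝ → Lp ℝ 2 μ →L[ℝ] Lp ℝ 2 μ}

/-- A smoothing estimate for bounded integrable nonnegative functions extends to `L²`. -/
lemma eLpNorm_apply_le_of_nonneg_bounded (hT : IsSymmetricMarkovSemigroup E T) {t : ℝ} (ht : 0 ≤ t)
    {q : ENNReal} {C : ℝ}
    (h : ∀ (f : Lp ℝ 2 μ) (M : ℝ), 1 ≤ M → 0 ≤ f → (∀ᵐ x ∂μ, f x ≤ M) → Integrable f μ →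
      eLpNorm (T t f) q μ ≤ ENNReal.ofReal C * eLpNorm f 2 μ) (f : Lp ℝ 2 μ) :
    eLpNorm (T t f) q μ ≤ ENNReal.ofReal C * eLpNorm f 2 μ := by
  have h1 : eLpNorm (T t f) q μ ≤ eLpNorm (T t |f|) q μ := by
    refine eLpNorm_mono_ae ?_
    filter_upwards [(Lp.coeFn_le _ _).2 (hT.abs_apply_le ht f), Lp.coeFn_abs (T t f)] with x h1 h2
    rw [h2] at h1
    exact h1.trans (le_abs_self _)
  refine h1.trans ?_
  obtain ⟨s, hs, s0, -, -, sL⟩ := exists_simpleFunc_nonneg_tendsto |f| (abs_nonneg f)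
  have l1 := ((T t).continuous.tendsto _).comp sL
  obtain ⟨ns, hns, hae⟩ := (tendstoInMeasure_of_tendsto_Lp l1).exists_seq_tendsto_ae
  have l2 : Tendsto (fun n => ENNReal.ofReal C * eLpNorm ((hs (ns n)).toLp) 2 μ) atTop
      (𝓝 (ENNReal.ofReal C * eLpNorm f 2 μ)) := by
    refine ENNReal.Tendsto.const_mul ?_ (Or.inr ENNReal.ofReal_ne_top)
    have h3 := (sL.comp hns.tendsto_atTop).enorm
    simp only [Function.comp, Lp.enorm_def] at h3
    refine h3.trans_eq ?_
    congr 1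
    refine eLpNorm_congr_norm_ae ?_
    filter_upwards [Lp.coeFn_abs f] with x hx
    rw [hx, Real.norm_eq_abs, abs_abs, Real.norm_eq_abs]
  -- Only `L²` convergence is available, so the `L^q` bound, possibly with `q = ∞`, passes to the
  -- limit by lower semicontinuity along an a.e. convergent subsequence.
  refine (Lp.eLpNorm_lim_le_liminf_eLpNorm (fun n => Lp.aestronglyMeasurable _) _ hae).trans ?_
  rw [← l2.liminf_eq]
  refine liminf_le_liminf (Eventually.of_forall fun n => ?_)
  obtain ⟨M, hM⟩ := (s (ns n)).exists_forall_norm_le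
  refine h _ (max M 1) (le_max_right _ _) ?_ ?_ ?_
  · rw [← Lp.coeFn_nonneg]
    filter_upwards [(hs (ns n)).coeFn_toLp] with x hx
    rw [hx]
    exact s0 _ x
  · filter_upwards [(hs (ns n)).coeFn_toLp] with x hx
    rw [hx]
    exact (Real.le_norm_self _).trans ((hM x).trans (le_max_left _ _))
  · refine (integrable_congr (hs (ns n)).coeFn_toLp).2 (SimpleFunc.integrable_iff_finMeasSupp.2
      ((SimpleFunc.memLp_iff_finMeasSupp two_ne_zero ENNReal.ofNat_ne_top).1 (hs (ns n))))

lemma eLpNorm_apply_eq (hT : IsSymmetricMarkovSemigroup E T) {t M q : ℝ} (ht : 0 ≤ t) (hM : 0 ≤ M)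
    (hq : 1 ≤ q) {f : Lp ℝ 2 μ} (hf : 0 ≤ f) (hfM : ∀ᵐ x ∂μ, f x ≤ M) (hfi : Integrable f μ) :
    eLpNorm (T t f) (ENNReal.ofReal q) μ = ENNReal.ofReal ((∫ x, T t f x ^ q ∂μ) ^ q⁻¹) := by
  have hb := hT.ae_mem_Icc_apply ht hM hf hfM
  have hi := integrable_rpow_of_le (hT.integrable_apply ht hf hfi) (hb.mono fun x h => h.1)
    (hb.mono fun x h => h.2) hq
  have e : (fun x => ‖T t f x‖ ^ q) =ᵐ[μ] fun x => T t f x ^ q := by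
    filter_upwards [hb] with x hx
    rw [Real.norm_of_nonneg hx.1]
  have hq0 : ENNReal.ofReal q ≠ 0 := by simpa using by linarith
  have hq1 : (ENNReal.ofReal q).toReal = q := ENNReal.toReal_ofReal (by linarith)
  have hm : MemLp (T t f) (ENNReal.ofReal q) μ := by
    rw [← integrable_norm_rpow_iff (Lp.aestronglyMeasurable _) hq0 ENNReal.ofReal_ne_top, hq1]
    exact (integrable_congr e).2 hi
  rw [hm.eLpNorm_eq_integral_rpow_norm hq0 ENNReal.ofReal_ne_top, hq1, integral_congr_ae e]

/-- Iterated hypercontractivity, starting from `L²`. -/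
lemma hypercontractive_chain (hT : IsSymmetricMarkovSemigroup E T) {ε b p : ℕ → ℝ}
    (hε : ∀ k, 0 < ε k) (hLS : ∀ k, LogSobolevAt E (ε k) (b k)) (hp0 : p 0 = 2)
    (hp : Monotone p) {M : ℝ} (hM : 1 ≤ M) {f : Lp ℝ 2 μ} (hf : 0 ≤ f)
    (hfM : ∀ᵐ x ∂μ, f x ≤ M) (hfi : Integrable f μ) {σ : ℝ} (hσ : 0 < σ) (n : ℕ) :
    (∫ x, T (σ + ∑ k ∈ Finset.range n, ε k / 2 * Real.log ((p (k + 1) - 1) / (p k - 1))) f x ^ p n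
        ∂μ) ^ (p n)⁻¹ ≤
      Real.exp (∑ k ∈ Finset.range n, 2 * b k * ((p k)⁻¹ - (p (k + 1))⁻¹)) * ‖f‖ := by
  have hp2 : ∀ k, 2 ≤ p k := fun k => hp0 ▸ hp (Nat.zero_le k)
  induction n with
  | zero =>
    simp only [Finset.range_zero, Finset.sum_empty, add_zero, Real.exp_zero, one_mul, hp0]
    rw [integral_rpow_two]
    exact hT.norm_apply_le hσ.le f
  | succ n ih =>
    have hsum : 0 ≤ ∑ k ∈ Finset.range n, ε k / 2 * Real.log ((p (k + 1) - 1) / (p k - 1)) :=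
      Finset.sum_nonneg fun k _ => mul_nonneg (by linarith [hε k]) (Real.log_nonneg
        ((one_le_div (by linarith [hp2 k])).2 (by linarith [hp (Nat.le_succ k)])))
    have h := hT.hypercontractive_integral (hε n) (hLS n) (add_pos_of_pos_of_nonneg hσ hsum)
      (hp2 n) (hp (Nat.le_succ n)) hM hf hfM hfi
    rw [Finset.sum_range_succ, Finset.sum_range_succ, ← add_assoc, Real.exp_add,
      mul_comm (Real.exp _) (Real.exp _), mul_assoc (Real.exp _)]
    exact h.trans (mul_le_mul_of_nonneg_left ih (Real.exp_pos _).le)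

lemma logSobolevAt {β : ℝ → ℝ} (h : LogSobolev E β) {ε : ℝ} (hε : 0 < ε) :
    LogSobolevAt E ε (β ε) := fun f hf => (h ε hε f hf).2

lemma supercontractive_of_logSobolev (hT : IsSymmetricMarkovSemigroup E T) {β : ℝ → ℝ}
    (h : LogSobolev E β) : IsSupercontractive T := by
  -- With `ε = t / log q` the move from 2 to `q` takes time `(ε/2) log(q-1) ≤ t/2`. The positive
  -- time left over is spent first, in `L²`, since differentiability holds only for positive times.
  refine ⟨fun t q => Real.exp (2 * β (t / Real.log q) * (2⁻¹ - q⁻¹)), fun q hq t ht =>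
    ⟨(Real.exp_pos _).le, fun u₀ => hT.eLpNorm_apply_le_of_nonneg_bounded ht.le ?_ u₀⟩⟩
  intro f M hM hf hfM hfi
  have hlog : 0 < Real.log q := Real.log_pos (by linarith)
  have hε : 0 < t / Real.log q := div_pos ht hlog
  have hlog1 : Real.log ((q - 1) / (2 - 1)) ≤ Real.log q :=
    Real.log_le_log (by norm_num; linarith) (by norm_num)
  have hτ : t / Real.log q / 2 * Real.log ((q - 1) / (2 - 1)) ≤ t / 2 := by
    refine (mul_le_mul_of_nonneg_left hlog1 (by positivity)).trans (le_of_eq ?_)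
    field_simp
  have hσ : 0 < t - t / Real.log q / 2 * Real.log ((q - 1) / (2 - 1)) := by linarith
  have key := hT.hypercontractive_integral hε (logSobolevAt h hε) hσ le_rfl hq hM hf hfM hfi
  rw [sub_add_cancel] at key
  rw [hT.eLpNorm_apply_eq ht.le (by linarith) (by linarith) hf hfM hfi, ← Lp.enorm_def,
    ← ofReal_norm, ← ENNReal.ofReal_mul (Real.exp_pos _).le]
  refine ENNReal.ofReal_le_ofReal (key.trans (mul_le_mul_of_nonneg_left ?_ (Real.exp_pos _).le))
  rw [integral_rpow_two]
  exact hT.norm_apply_le hσ.le f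

/-- In each dyadic interval there is a point where `β` is at most its average. -/
lemma exists_dyadic_points {β : ℝ → ℝ} (hβ : ContinuousOn β (Ioi 0)) {t : ℝ} (ht : 0 < t)
    (hfin : (∫⁻ s in Ioc 0 t, ENNReal.ofReal (β s)) < ⊤) :
    ∃ (ε J : ℕ → ℝ) (I : ℝ), (∀ k, 0 < ε k) ∧ (∀ k, ε k ≤ t * (1 / 2) ^ k) ∧
      (∀ k, 0 ≤ J k) ∧ (∀ k, β (ε k) ≤ J k * 2 ^ (k + 1) / t) ∧
      ∀ n, ∑ k ∈ Finset.range n, J k ≤ I := by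
  set a : ℕ → ℝ := fun k => t * (1 / 2) ^ k with ha
  have ha0 : ∀ k, 0 < a k := fun k => by positivity
  have hanti : Antitone a := fun m n h =>
    mul_le_mul_of_nonneg_left (pow_le_pow_of_le_one (by norm_num) (by norm_num) h) ht.le
  have hlen : ∀ k, a k - a (k + 1) = t / 2 ^ (k + 1) := fun k => by
    simp only [ha, pow_succ]
    rw [one_div, inv_pow]
    field_simp
    ring
  set J : ℕ → ENNReal := fun k => ∫⁻ s in Ioc (a (k + 1)) (a k), ENNReal.ofReal (β s) with hJ
  have hsum : ∀ n, ∑ k ∈ Finset.range n, J k =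
      ∫⁻ s in Ioc (a n) (a 0), ENNReal.ofReal (β s) := by
    intro n
    induction n with
    | zero => simp
    | succ n ih =>
      rw [Finset.sum_range_succ, ih, ← Ioc_union_Ioc_eq_Ioc (hanti (Nat.le_succ n))
        (hanti (Nat.zero_le n)), lintegral_union measurableSet_Ioc, add_comm]
      exact Ioc_disjoint_Ioc_of_le le_rfl
  have hsumle : ∀ n, ∑ k ∈ Finset.range n, J k ≤ ∫⁻ s in Ioc 0 t, ENNReal.ofReal (β s) := by
    intro n
    rw [hsum]
    refine lintegral_mono_set (Ioc_subset_Ioc (ha0 n).le ?_)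
    simp [ha]
  have hJfin : ∀ k, J k ≠ ⊤ := fun k => ((Finset.single_le_sum (fun _ _ => zero_le)
    (Finset.self_mem_range_succ k)).trans (hsumle (k + 1))).trans_lt hfin |>.ne
  have hex : ∀ k, ∃ ε ∈ Ioc (a (k + 1)) (a k), β ε ≤ (J k).toReal * 2 ^ (k + 1) / t := by
    intro k
    have hvol : volume (Ioc (a (k + 1)) (a k)) = ENNReal.ofReal (t / 2 ^ (k + 1)) := by
      rw [Real.volume_Ioc, hlen]
    have hpos : 0 < t / 2 ^ (k + 1) := by positivity
    -- The average of `β⁺` over the interval is `J k` divided by its length `t / 2^{k+1}`.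
    obtain ⟨ε, hε, hle⟩ := exists_le_setLAverage (μ := volume) (s := Ioc (a (k + 1)) (a k))
      (f := fun s => ENNReal.ofReal (β s)) (by rw [hvol]; simpa using hpos)
      (by rw [hvol]; exact ENNReal.ofReal_ne_top)
      (((hβ.mono fun s hs => (ha0 _).trans hs.1).aemeasurable measurableSet_Ioc).ennreal_ofReal)
    refine ⟨ε, hε, ?_⟩
    rw [setLAverage_eq, hvol] at hle
    change _ ≤ J k / _ at hle
    rw [← ENNReal.ofReal_toReal (hJfin k), ← ENNReal.ofReal_div_of_pos hpos,
      ENNReal.ofReal_le_ofReal_iff (by positivity)] at hle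
    refine hle.trans (le_of_eq ?_)
    field_simp
  choose ε hε hβε using hex
  refine ⟨ε, fun k => (J k).toReal, (∫⁻ s in Ioc 0 t, ENNReal.ofReal (β s)).toReal,
    fun k => (ha0 _).trans (hε k).1, fun k => (hε k).2, fun k => ENNReal.toReal_nonneg, hβε,
    fun n => ?_⟩
  rw [← ENNReal.toReal_sum fun k _ => hJfin k]
  exact ENNReal.toReal_mono hfin.ne (hsumle n)

/-- Chaining the moves through `p_k = 1 + 2^k` bounds every `L^{p_n}` norm at the same time `t` by
the same constant, and `n → ∞` gives `L^∞`. As `p_k - 1` doubles, move `k` takes time `ε_k (log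
2)/2`, and these times sum to less than `t`. -/
lemma exists_ultracontractive_bound (hT : IsSymmetricMarkovSemigroup E T) {β : ℝ → ℝ}
    (hβ : ContinuousOn β (Ioi 0)) (h : LogSobolev E β) {t : ℝ} (ht : 0 < t)
    (hfin : (∫⁻ s in Ioc 0 t, ENNReal.ofReal (β s)) < ⊤) :
    ∃ C : ℝ, 1 ≤ C ∧ ∀ f : Lp ℝ 2 μ, eLpNorm (T t f) ⊤ μ ≤ ENNReal.ofReal C * eLpNorm f 2 μ := by
  obtain ⟨ε, J, I, hε, hεle, hJ0, hJ, hI⟩ := exists_dyadic_points hβ ht hfin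
  have hI0 : 0 ≤ I := by simpa using hI 0
  refine ⟨Real.exp (2 / t * I), Real.one_le_exp (by positivity), fun u =>
    hT.eLpNorm_apply_le_of_nonneg_bounded ht.le ?_ u⟩
  intro f M hM hf hfM hfi
  set p : ℕ → ℝ := fun k => 1 + 2 ^ k with hp
  have hpmono : Monotone p := fun m n hmn => by
    have : (2 : ℝ) ^ m ≤ 2 ^ n := pow_le_pow_right₀ (by norm_num) hmn
    simp only [hp]
    linarith
  have hratio : ∀ k, (p (k + 1) - 1) / (p k - 1) = 2 := fun k => by
    simp only [hp, pow_succ]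
    field_simp
    ring
  have hlog2 : Real.log 2 ≤ 1 := by linarith [Real.log_two_lt_d9]
  have hlog0 : 0 < Real.log 2 := Real.log_pos (by norm_num)
  refine eLpNorm_top_le_of_forall_le (Lp.aestronglyMeasurable _) (p := fun n => 1 + 2 ^ n)
    (fun n => by have := Nat.lt_two_pow_self (n := n); omega) fun n => ?_
  have hτ : ∑ k ∈ Finset.range n, ε k / 2 * Real.log ((p (k + 1) - 1) / (p k - 1)) < t := by
    have h1 : ∀ m, ∑ k ∈ Finset.range m, ε k / 2 * Real.log ((p (k + 1) - 1) / (p k - 1)) ≤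
        t * (1 - (1 / 2) ^ m) := by
      intro m
      induction m with
      | zero => simp
      | succ m ih =>
        rw [Finset.sum_range_succ, hratio, pow_succ]
        have : ε m / 2 * Real.log 2 ≤ t * (1 / 2) ^ m / 2 := by
          have := hεle m
          have := hε m
          nlinarith
        linarith
    refine (h1 n).trans_lt ?_
    have : (0 : ℝ) < (1 / 2) ^ n := by positivity
    nlinarith
  have key := hT.hypercontractive_chain hε (fun k => logSobolevAt h (hε k)) (p := p)
    (by norm_num [hp]) hpmono hM hf hfM hfi (sub_pos.2 hτ) n
  rw [sub_add_cancel] at key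
  -- The gain `1/p_k - 1/p_{k+1} ≤ 2^{-(k+1)}` cancels the `2^{k+1}` from averaging. Replacing
  -- `β(ε_k)` by the nonnegative average comes first, since `β` may be negative.
  have hexp : ∑ k ∈ Finset.range n, 2 * β (ε k) * ((p k)⁻¹ - (p (k + 1))⁻¹) ≤ 2 / t * I := by
    calc ∑ k ∈ Finset.range n, 2 * β (ε k) * ((p k)⁻¹ - (p (k + 1))⁻¹)
        ≤ ∑ k ∈ Finset.range n, 2 / t * J k := by
          refine Finset.sum_le_sum fun k _ => ?_
          have hx : (1 : ℝ) ≤ 2 ^ k := one_le_pow₀ (by norm_num)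
          have h1 : 0 ≤ (p k)⁻¹ - (p (k + 1))⁻¹ := sub_nonneg.2
            (inv_anti₀ (by simp only [hp]; positivity) (hpmono (Nat.le_succ k)))
          have h2 : (p k)⁻¹ - (p (k + 1))⁻¹ ≤ (2 ^ (k + 1))⁻¹ := by
            simp only [hp, pow_succ]
            generalize (2 : ℝ) ^ k = x at hx ⊢
            rw [inv_sub_inv (by positivity) (by positivity), ← one_div, div_le_div_iff₀
              (by positivity) (by positivity)]
            nlinarith
          have h3 : 0 ≤ J k * 2 ^ (k + 1) / t := by have := hJ0 k; positivity
          calc 2 * β (ε k) * ((p k)⁻¹ - (p (k + 1))⁻¹)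
              ≤ 2 * (J k * 2 ^ (k + 1) / t) * ((p k)⁻¹ - (p (k + 1))⁻¹) :=
                mul_le_mul_of_nonneg_right (by linarith [hJ k]) h1
            _ ≤ 2 * (J k * 2 ^ (k + 1) / t) * (2 ^ (k + 1))⁻¹ :=
                mul_le_mul_of_nonneg_left h2 (by linarith)
            _ = 2 / t * J k := by field_simp
      _ = 2 / t * ∑ k ∈ Finset.range n, J k := by rw [Finset.mul_sum]
      _ ≤ 2 / t * I := mul_le_mul_of_nonneg_left (hI n) (by positivity)
  have hcast : (((1 + 2 ^ n : ℕ)) : ENNReal) = ENNReal.ofReal (p n) := by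
    rw [← ENNReal.ofReal_natCast]
    congr 1
    simp [hp]
  have hp1 : 1 ≤ p n := by
    have : (0 : ℝ) < 2 ^ n := by positivity
    simp only [hp]
    linarith
  rw [hcast, hT.eLpNorm_apply_eq ht.le (by linarith) hp1 hf hfM hfi, ← Lp.enorm_def,
    ← ofReal_norm, ← ENNReal.ofReal_mul (Real.exp_pos _).le]
  exact ENNReal.ofReal_le_ofReal (key.trans
    (mul_le_mul_of_nonneg_right (Real.exp_le_exp.2 hexp) (norm_nonneg _)))

lemma ultracontractive_of_logSobolev (hT : IsSymmetricMarkovSemigroup E T) {β : ℝ → ℝ}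
    (hβ : ContinuousOn β (Ioi 0)) (h : LogSobolev E β)
    (hfin : ∀ t : ℝ, 0 < t → (∫⁻ s in Ioc 0 t, ENNReal.ofReal (β s)) < ⊤) :
    IsUltracontractive T := by
  have hex : ∀ t : ℝ, ∃ C : ℝ, 1 ≤ C ∧ (0 < t → ∀ f : Lp ℝ 2 μ,
      eLpNorm (T t f) ⊤ μ ≤ ENNReal.ofReal C * eLpNorm f 2 μ) := by
    intro t
    by_cases ht : 0 < t
    · obtain ⟨C, hC, hb⟩ := hT.exists_ultracontractive_bound hβ h ht (hfin t ht)
      exact ⟨C, hC, fun _ => hb⟩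
    · exact ⟨1, le_rfl, fun h => absurd h ht⟩
  choose C hC1 hC using hex
  have himage : ∀ t, (fun _ : ℝ => C t) '' Ici 2 = {C t} := fun t =>
    nonempty_Ici.image_const (C t)
  refine ⟨fun t _ => C t, fun q hq t ht => ⟨by linarith [hC1 t], fun f => ?_⟩, fun t _ => ?_,
    fun t ht => ?_⟩
  · refine eLpNorm_le_of_le_two_of_le_top ?_ (hC t ht f) hq
    have h1 : eLpNorm (T t f) 2 μ ≤ eLpNorm f 2 μ := by
      rw [← Lp.enorm_def, ← Lp.enorm_def, ← ofReal_norm, ← ofReal_norm]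
      exact ENNReal.ofReal_le_ofReal (hT.norm_apply_le ht.le f)
    refine h1.trans (le_mul_of_one_le_left zero_le ?_)
    rw [ENNReal.one_le_ofReal]
    exact hC1 t
  · rw [himage]
    exact bddAbove_singleton
  · simp only [himage, csSup_singleton]
    exact ⟨by linarith [hC1 t], hC t ht⟩

end IsSymmetricMarkovSemigroup

theorem mainTheorem5 {X : Type*} [MeasurableSpace X] (μ : Measure X) (E : ClosedForm μ)
    (T : ℝ → Lp ℝ 2 μ →L[ℝ] Lp ℝ 2 μ) (hT : IsSymmetricMarkovSemigroup E T) :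
    -- supercontractivity implies the family of logarithmic Sobolev inequalities
    (∀ B : ℝ → ℝ → ℝ, SupercontractiveWith T B → ∀ q : ℝ, 2 < q →
      LogSobolev E (fun ε => (1 - 2 / q)⁻¹ * Real.log (B (ε * (1 - 2 / q)) q))) ∧
    -- ultracontractivity implies the family of logarithmic Sobolev inequalities
    (∀ B : ℝ → ℝ, UltracontractiveWith T B → LogSobolev E (fun ε => Real.log (B ε))) ∧
    -- conversely, the family with a continuous `β` implies supercontractivity
    (∀ β : ℝ → ℝ, ContinuousOn β (Ioi 0) → LogSobolev E β → IsSupercontractive T) ∧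
    -- if moreover `(1 / t) ∫₀ᵗ β < ∞` for all `t > 0`, it implies ultracontractivity
    (∀ β : ℝ → ℝ, ContinuousOn β (Ioi 0) → LogSobolev E β →
      (∀ t : ℝ, 0 < t → (∫⁻ s in Ioc 0 t, ENNReal.ofReal (β s)) < ⊤) →
      IsUltracontractive T) :=
  ⟨fun _ hB _ hq => hT.logSobolev_of_supercontractive hB hq,
    fun _ hB => hT.logSobolev_of_ultracontractive hB,
    fun _ _ h => hT.supercontractive_of_logSobolev h,
    fun _ hβ h hfin => hT.ultracontractive_of_logSobolev hβ h hfin⟩
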